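/- **Theorem.** For an integrable even function $k$ on $[-\pi,\pi]$ let $\widehat{k}(\tau)=\int_{-\pi}^{\pi}e^{\sqrt{-1}\,\tau\lambda}k(\lambda)\,d\lambda$, $\tau\in\mathbb{Z}$, and let $\Sigma_n(k)$ be the $n\times n$ matrix with entries $\widehat{k}(i-j)$, $1\le i,j\le n$. Let $\alpha_1,\alpha_2<1$ be real numbers and let $p\ge 1$ be an integer. For $i=1,2$ let $k_i^n:[-\pi,\pi]\to[-\infty,\infty]$, $n\ge 1$, be Lebesgue measurable even functions such that 1. $\displaystyle\sup_{n\ge 1,\ \lambda\in[-\pi,\pi]\setminus\{0\}}|\lambda|^{\alpha_i}\,|k_i^n(\lambda)|<\infty$; 2. there is a function $k_i:[-\pi,\pi]\to[-\infty,\infty]$, whose set of discontinuities has Lebesgue measure $0$, such that $\displaystyle\lim_{n\to\infty}\operatorname*{ess\,sup}_{\lambda\in[-\pi,\pi]}|k_i^n(\lambda)-k_i(\lambda)|=0$. Then: (a) If $p(\alpha_1+\alpha_2)<1$, then $[k_1k_2]^p$ is integrable on $[-\pi,\pi]$ and $$\lim_{n\to\infty}\frac1n\,\mathrm{Tr}\big[(\Sigma_n(k_1^n)\Sigma_n(k_2^n))^p\big]=(2\pi)^{2p-1}\int_{-\pi}^{\pi}[k_1(\lambda)k_2(\lambda)]^p\,d\lambda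 .$$ (b) If $p(\alpha_1+\alpha_2)\ge 1$, then for every $\psi>0$, $$\mathrm{Tr}\big[(\Sigma_n(k_1^n)\Sigma_n(k_2^n))^p\big]=o\big(n^{p(\alpha_1+\alpha_2)+\psi}\big)\qquad\text{as } n\to\infty .$$ -/

import Mathlib

open MeasureTheory Filter Topology Asymptotics

/-- The Fourier coefficient `∫_{-π}^{π} e^{iτx} k(x) dx` of an extended-real-valued function `k` on
`[-π, π]` (only the values of `k` on `[-π, π]` matter). The function `EReal.toReal` is the identity on
finite values; it is used for functions that are finite almost everywhere. -/
noncomputable def fourierCoefficient (k : ℝ → EReal) (τ : ℤ) : ℂ :=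
  ∫ x in Set.Icc (-Real.pi) Real.pi,
    Complex.exp (Complex.I * (τ : ℂ) * (x : ℂ)) * (((k x).toReal : ℝ) : ℂ)

/-- The `n × n` Toeplitz matrix `Σ_n(k)`, whose `(i, j)` entry is the `(i - j)`-th Fourier
coefficient of `k`. -/
noncomputable def toeplitzMatrix (n : ℕ) (k : ℝ → EReal) : Matrix (Fin n) (Fin n) ℂ :=
  Matrix.of fun i j => fourierCoefficient k (((i : ℕ) : ℤ) - ((j : ℕ) : ℤ))

/-- The trace `Tr[(Σ_n(f) Σ_n(g))^p]`. -/
noncomputable def toeplitzTrace (n p : ℕ) (f g : ℝ → EReal) : ℂ :=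
  ((toeplitzMatrix n f * toeplitzMatrix n g) ^ p).trace

/-- `k` is even on `[-π, π]`. -/
def EvenOnInterval (k : ℝ → EReal) : Prop :=
  ∀ x ∈ Set.Icc (-Real.pi) Real.pi, k (-x) = k x

/-- `sup { |x|^α |k^n(x)| : n ≥ 1, x ∈ [-π, π] \ {0} } < ∞`, the supremum being taken in `[0, ∞]`. -/
def UniformPowerBound (α : ℝ) (k : ℕ → ℝ → EReal) : Prop :=
  (⨆ (n : ℕ) (_ : 1 ≤ n) (x : ℝ) (_ : x ∈ Set.Icc (-Real.pi) Real.pi \ {0}),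
    ENNReal.ofReal (|x| ^ α) * (k n x).abs) < ⊤

/-- `ess sup_{x ∈ [-π, π]} |k^n(x) - l(x)| → 0` as `n → ∞`, the essential suprema being taken in
`[0, ∞]` with respect to Lebesgue measure. -/
def TendstoEssSup (k : ℕ → ℝ → EReal) (l : ℝ → EReal) : Prop :=
  Tendsto (fun n => essSup (fun x => (k n x - l x).abs)
    (volume.restrict (Set.Icc (-Real.pi) Real.pi))) atTop (𝓝 0)

/-- The discontinuities of `l`, as a function from `[-π, π]` to `[-∞, ∞]`, have Lebesgue
measure zero. -/
def NullDiscontinuities (l : ℝ → EReal) : Prop :=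
  volume {x ∈ Set.Icc (-Real.pi) Real.pi |
    ¬ ContinuousWithinAt l (Set.Icc (-Real.pi) Real.pi) x} = 0

/-! For nonnegative symbols the matrices A = Σ_n(f) and B = Σ_n(g) are positive semidefinite. With a
Hermitian square root Y of B, Tr (AB)^p = Tr (YAY)^p, so (Tr (AB)^p)^(1/p) is the Schatten p-norm of
YAY. It is therefore subadditive and monotone in A, and by symmetry in B. This quantity, `traceNorm`
for matrices and `psi` for symbols, lets the symbols be cut into pieces that are estimated
separately.

Cut f and g dyadically at |x| ~ π/2^j, with j ≤ J = log₂ n. The piece of f at level j has mass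
O(2^(-j(1-α))) and operator norm O(2^(jα)); at level J the norm bound is n times the mass. For
adjacent levels the operator norms and the trace suffice. For distant levels the Schatten 1-norm ∬
f(x)g(y)|D_n(x-y)|², with D_n the Dirichlet kernel, is small because D_n is evaluated away from its
peak. Together (`exists_psi_piece_le`), for j ≤ k, a pair of pieces contributes at most a constant
times n^(1/p) 2^(j(α+β-1/p)) 2^(-δ(k-j)), where δ = min(1-α, 1-β).

If p(α+β) < 1 the sum over pairs is geometric, so the part of the symbols near 0 costs a uniformly
small multiple of n^(1/p) (`exists_psi_tail_le`). Away from 0 the symbols are bounded and converge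
uniformly. There Σ_n(f)Σ_n(g) agrees with 2πΣ_n(fg) up to o(n) in squared Frobenius norm: the error
is the Parseval defect of the truncated Fourier series (`frobSq_toep_mul_toep_sub_le`). This gives
the limit for bounded symbols (`tendsto_trace_of_memLp_top`), and `tendsto_psi` combines the two. If
p(α+β) ≥ 1, each of the (J+1)² pairs contributes O(n^(α+β)), and the logarithms are absorbed by n^ψ
(`exists_psi_le_log`).

Signed symbols are reduced to nonnegative ones algebraically. The power (P + tQ)^p is a polynomial
of degree at most p in t, so its value at t = -1 is a fixed combination of its values at t = 0, …, p
(`sub_pow_eq_sum`). With f = f⁺ - f⁻ this expresses the signed trace through the nonnegative symbols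
f⁺ + k f⁻. -/

namespace Toeplitz

open scoped ComplexOrder

/-! ### Trace inequalities for positive semidefinite matrices. -/

section Matrices

variable {ι : Type*} [Fintype ι] [DecidableEq ι]

/-- Diagonalization of a positive semidefinite matrix. -/
lemma exists_diagonalization {C : Matrix ι ι ℂ} (hC : C.PosSemidef) :
    ∃ (U : Matrix ι ι ℂ) (d : ι → ℝ), star U * U = 1 ∧ U * star U = 1 ∧ (∀ i, 0 ≤ d i) ∧
      C = U * Matrix.diagonal (fun i => (d i : ℂ)) * star U := by
  refine ⟨hC.1.eigenvectorUnitary, hC.1.eigenvalues, ?_, ?_, hC.eigenvalues_nonneg, ?_⟩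
  · exact Unitary.coe_star_mul_self _
  · exact Unitary.coe_mul_star_self _
  · conv_lhs => rw [hC.1.spectral_theorem]
    rw [Unitary.conjStarAlgAut_apply]
    rfl

lemma conj_pow {U D : Matrix ι ι ℂ} (hU : star U * U = 1) (hU' : U * star U = 1) (q : ℕ) :
    (U * D * star U) ^ q = U * D ^ q * star U := by
  induction q with
  | zero => simp [hU']
  | succ q ih =>
    rw [pow_succ, ih, pow_succ]
    calc U * D ^ q * star U * (U * D * star U)
        = U * D ^ q * (star U * U) * D * star U := by simp only [mul_assoc]
      _ = _ := by rw [hU]; simp only [mul_assoc, one_mul]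

lemma trace_pow_of_diagonalization {C U : Matrix ι ι ℂ} {d : ι → ℝ}
    (hU : star U * U = 1) (hU' : U * star U = 1)
    (h : C = U * Matrix.diagonal (fun i => (d i : ℂ)) * star U) (q : ℕ) :
    (C ^ q).trace = ((∑ i, d i ^ q : ℝ) : ℂ) := by
  rw [h, conj_pow hU hU', Matrix.trace_mul_comm, ← mul_assoc, hU, one_mul, Matrix.diagonal_pow,
    Matrix.trace_diagonal]
  simp

/-- The trace of a power of a positive semidefinite matrix is real. -/
lemma trace_pow_eq_re {C : Matrix ι ι ℂ} (hC : C.PosSemidef) (q : ℕ) :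
    (C ^ q).trace = (((C ^ q).trace.re : ℝ) : ℂ) := by
  obtain ⟨U, d, hU, hU', -, h⟩ := exists_diagonalization hC
  rw [trace_pow_of_diagonalization hU hU' h, Complex.ofReal_re]

lemma trace_pow_re_nonneg {C : Matrix ι ι ℂ} (hC : C.PosSemidef) (q : ℕ) :
    0 ≤ (C ^ q).trace.re := by
  obtain ⟨U, d, hU, hU', hd, h⟩ := exists_diagonalization hC
  rw [trace_pow_of_diagonalization hU hU' h, Complex.ofReal_re]
  exact Finset.sum_nonneg fun i _ => pow_nonneg (hd i) _

lemma conj_diagonal_apply (W : Matrix ι ι ℂ) (d : ι → ℝ) (i : ι) :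
    ((W * Matrix.diagonal (fun i => (d i : ℂ)) * star W) i i).re =
      ∑ k, ‖W i k‖ ^ 2 * d k := by
  rw [Matrix.mul_apply, Complex.re_sum]
  refine Finset.sum_congr rfl fun k _ => ?_
  rw [Matrix.mul_diagonal, Matrix.star_apply, mul_right_comm, Complex.star_def, Complex.mul_conj,
    ← Complex.ofReal_mul, Complex.ofReal_re, Complex.normSq_eq_norm_sq]

lemma sum_row_norm_sq {W : Matrix ι ι ℂ} (hW : W * star W = 1) (i : ι) :
    ∑ k, ‖W i k‖ ^ 2 = 1 := by
  have := conj_diagonal_apply W (fun _ => 1) i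
  simp only [mul_one, Complex.ofReal_one] at this
  rw [← this]
  have h1 : (Matrix.diagonal fun _ : ι => (1 : ℂ)) = 1 := Matrix.diagonal_one
  rw [h1, mul_one, hW]
  simp

lemma sum_col_norm_sq {W : Matrix ι ι ℂ} (hW : star W * W = 1) (k : ι) :
    ∑ i, ‖W i k‖ ^ 2 = 1 := by
  have := sum_row_norm_sq (W := star W) (by simpa using hW) k
  simpa [Matrix.star_apply] using this

/-- The Peierls inequality: the sum of the `p`-th powers of the diagonal entries in an orthonormal
basis is at most the trace of the `p`-th power. -/
lemma sum_diag_pow_le_trace_pow {C V : Matrix ι ι ℂ} (hC : C.PosSemidef)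
    (hV : star V * V = 1) (hV' : V * star V = 1) (p : ℕ) :
    ∑ i, ((star V * C * V) i i).re ^ p ≤ (C ^ p).trace.re := by
  obtain ⟨U, d, hU, hU', hd, h⟩ := exists_diagonalization hC
  -- The diagonal entries of C in the basis V are averages of its eigenvalues with weights ‖W i k‖².
  -- These weights are doubly stochastic: the row sums allow Jensen, and the column sums collapse
  -- the double sum.
  set W := star V * U with hWdef
  have hsW : star W = star U * V := by simp [hWdef]
  have hW1 : W * star W = 1 := by
    rw [hsW, hWdef]
    calc star V * U * (star U * V) = star V * (U * star U) * V := by simp only [mul_assoc]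
      _ = 1 := by rw [hU', mul_one, hV]
  have hW2 : star W * W = 1 := by
    rw [hsW, hWdef]
    calc star U * V * (star V * U) = star U * (V * star V) * U := by simp only [mul_assoc]
      _ = 1 := by rw [hV', mul_one, hU]
  have hCW : star V * C * V = W * Matrix.diagonal (fun i => (d i : ℂ)) * star W := by
    rw [hsW, hWdef, h]; simp only [mul_assoc]
  rw [trace_pow_of_diagonalization hU hU' h, Complex.ofReal_re, hCW]
  calc ∑ i, ((W * Matrix.diagonal (fun i => (d i : ℂ)) * star W) i i).re ^ p
      = ∑ i, (∑ k, ‖W i k‖ ^ 2 * d k) ^ p := by simp only [conj_diagonal_apply]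
    _ ≤ ∑ i, ∑ k, ‖W i k‖ ^ 2 * d k ^ p := by
        refine Finset.sum_le_sum fun i _ => ?_
        exact Real.pow_arith_mean_le_arith_mean_pow _ _ _ (fun k _ => sq_nonneg _)
          (sum_row_norm_sq hW1 i) (fun k _ => hd k) p
    _ = ∑ k, d k ^ p := by
        rw [Finset.sum_comm]
        refine Finset.sum_congr rfl fun k _ => ?_
        rw [← Finset.sum_mul, sum_col_norm_sq hW2, one_mul]

lemma conj_diag_re_nonneg {κ : Type*} [Fintype κ] {C : Matrix κ κ ℂ} (hC : C.PosSemidef)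
    (V : Matrix κ κ ℂ) (i : κ) :
    0 ≤ ((star V * C * V) i i).re := by
  have := (hC.conjTranspose_mul_mul_same V).diag_nonneg (i := i)
  exact (Complex.le_def.1 this).1

/-- An eigenbasis gives equality in the Peierls inequality, for all exponents at once. Comparisons
of two matrices can then be made on diagonal entries: exact for the matrix whose eigenbasis is used,
and an upper or lower estimate for the other. -/
lemma exists_basis_trace_pow {C : Matrix ι ι ℂ} (hC : C.PosSemidef) :
    ∃ V : Matrix ι ι ℂ, star V * V = 1 ∧ V * star V = 1 ∧
      ∀ p : ℕ, (C ^ p).trace.re = ∑ i, ((star V * C * V) i i).re ^ p := by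
  obtain ⟨U, d, hU, hU', hd, h⟩ := exists_diagonalization hC
  refine ⟨U, hU, hU', fun p => ?_⟩
  rw [trace_pow_of_diagonalization hU hU' h, Complex.ofReal_re]
  refine Finset.sum_congr rfl fun i _ => ?_
  have : star U * C * U = Matrix.diagonal (fun i => (d i : ℂ)) := by
    rw [h]
    calc star U * (U * Matrix.diagonal (fun i => (d i : ℂ)) * star U) * U
        = (star U * U) * Matrix.diagonal (fun i => (d i : ℂ)) * (star U * U) := by
          simp only [mul_assoc]
      _ = _ := by rw [hU, one_mul, mul_one]
  rw [this]; simp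

lemma trace_pow_mono {C D : Matrix ι ι ℂ} (hC : C.PosSemidef) (hD : D.PosSemidef) (p : ℕ) :
    (C ^ p).trace.re ≤ ((C + D) ^ p).trace.re := by
  obtain ⟨V, hV, hV', h⟩ := exists_basis_trace_pow hC
  rw [h p]
  refine le_trans (Finset.sum_le_sum fun i _ => ?_)
    (sum_diag_pow_le_trace_pow (hC.add hD) hV hV' p)
  refine pow_le_pow_left₀ (conj_diag_re_nonneg hC V i) ?_ p
  rw [mul_add, add_mul, Matrix.add_apply, Complex.add_re]
  linarith [conj_diag_re_nonneg hD V i]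

/-- The triangle inequality for the Schatten norm of positive semidefinite matrices. -/
lemma trace_pow_rpow_add_le {C D : Matrix ι ι ℂ} (hC : C.PosSemidef) (hD : D.PosSemidef)
    {p : ℕ} (hp : 1 ≤ p) :
    ((C + D) ^ p).trace.re ^ (1 / (p : ℝ)) ≤
      (C ^ p).trace.re ^ (1 / (p : ℝ)) + (D ^ p).trace.re ^ (1 / (p : ℝ)) := by
  -- In the eigenbasis of C + D the left side is an exact ℓ^p norm of diagonal entries. Minkowski
  -- splits it, and Peierls bounds each summand.
  obtain ⟨V, hV, hV', h⟩ := exists_basis_trace_pow (hC.add hD)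
  have hp' : (1 : ℝ) ≤ p := by exact_mod_cast hp
  have key := Real.Lp_add_le_of_nonneg (s := Finset.univ) (p := (p : ℝ))
    (f := fun i => ((star V * C * V) i i).re) (g := fun i => ((star V * D * V) i i).re) hp'
    (fun i _ => conj_diag_re_nonneg hC V i) (fun i _ => conj_diag_re_nonneg hD V i)
  simp only [Real.rpow_natCast] at key
  rw [h p]
  simp only [mul_add, add_mul, Matrix.add_apply, Complex.add_re]
  refine key.trans (add_le_add ?_ ?_)
  · exact Real.rpow_le_rpow (Finset.sum_nonneg fun i _ => pow_nonneg (conj_diag_re_nonneg hC V i) _)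
      (sum_diag_pow_le_trace_pow hC hV hV' p) (by positivity)
  · exact Real.rpow_le_rpow (Finset.sum_nonneg fun i _ => pow_nonneg (conj_diag_re_nonneg hD V i) _)
      (sum_diag_pow_le_trace_pow hD hV hV' p) (by positivity)

/-- Every eigenvalue λ lies in [0, c], so λ^p ≤ c^(p-1) λ. -/
lemma trace_pow_le_of_le {C : Matrix ι ι ℂ} (hC : C.PosSemidef) {c : ℝ}
    (hc : ((c : ℂ) • (1 : Matrix ι ι ℂ) - C).PosSemidef) {p : ℕ} (hp : 1 ≤ p) :
    (C ^ p).trace.re ≤ c ^ (p - 1) * C.trace.re := by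
  obtain ⟨V, hV, hV', h⟩ := exists_basis_trace_pow hC
  have h1 := h 1
  simp only [pow_one] at h1
  rw [h p, h1, Finset.mul_sum]
  refine Finset.sum_le_sum fun i _ => ?_
  have h0 := conj_diag_re_nonneg hC V i
  have h2 := conj_diag_re_nonneg hc V i
  rw [mul_sub, sub_mul, Matrix.sub_apply, Complex.sub_re, mul_smul_comm, mul_one, smul_mul_assoc,
    hV, Matrix.smul_apply, Matrix.one_apply_eq] at h2
  simp at h2
  obtain ⟨q, rfl⟩ := Nat.exists_eq_add_of_le hp
  rw [Nat.add_sub_cancel_left, pow_add, pow_one, mul_comm]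
  exact mul_le_mul_of_nonneg_right (pow_le_pow_left₀ h0 h2 _) h0

lemma trace_pow_le_trace_re_pow {C : Matrix ι ι ℂ} (hC : C.PosSemidef) {p : ℕ} (hp : 1 ≤ p) :
    (C ^ p).trace.re ≤ C.trace.re ^ p := by
  obtain ⟨V, hV, hV', h⟩ := exists_basis_trace_pow hC
  have h1 := h 1
  simp only [pow_one] at h1
  rw [h p, h1]
  obtain ⟨q, rfl⟩ := Nat.exists_eq_add_of_le' hp
  rw [pow_succ, Finset.mul_sum]
  refine Finset.sum_le_sum fun i _ => ?_
  have h0 := fun i => conj_diag_re_nonneg hC V i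
  rw [pow_succ]
  exact mul_le_mul_of_nonneg_right (pow_le_pow_left₀ (h0 i)
    (Finset.single_le_sum (fun i _ => h0 i) (Finset.mem_univ i)) _) (h0 i)

/-- A positive semidefinite matrix has a Hermitian square root. -/
lemma exists_sqrt {B : Matrix ι ι ℂ} (hB : B.PosSemidef) :
    ∃ Y : Matrix ι ι ℂ, Y.IsHermitian ∧ Y * Y = B := by
  obtain ⟨U, d, hU, hU', hd, h⟩ := exists_diagonalization hB
  refine ⟨U * Matrix.diagonal (fun i => (Real.sqrt (d i) : ℂ)) * star U, ?_, ?_⟩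
  · have hdiag : (Matrix.diagonal (fun i => (Real.sqrt (d i) : ℂ))).IsHermitian := by
      refine Matrix.isHermitian_diagonal_of_self_adjoint _ ?_
      ext i; simp
    have := Matrix.isHermitian_mul_mul_conjTranspose U hdiag
    exact this
  · rw [← pow_two, conj_pow hU hU', h, Matrix.diagonal_pow]
    congr 3
    ext i
    simp only [Pi.pow_apply]
    rw [← Complex.ofReal_pow, Real.sq_sqrt (hd i)]

lemma trace_mul_pow_comm (A B : Matrix ι ι ℂ) {p : ℕ} (hp : 1 ≤ p) :
    ((A * B) ^ p).trace = ((B * A) ^ p).trace := by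
  obtain ⟨q, rfl⟩ := Nat.exists_eq_add_of_le' hp
  have key : ∀ q : ℕ, (A * B) ^ q * A = A * (B * A) ^ q := by
    intro q
    induction q with
    | zero => simp
    | succ q ih => rw [pow_succ', mul_assoc, ih, pow_succ']; simp only [mul_assoc]
  rw [pow_succ, ← mul_assoc, key, mul_assoc, Matrix.trace_mul_comm, mul_assoc, ← pow_succ]

/-- `Tr (AB)^p = Tr (YAY)^p` for a Hermitian square root `Y` of `B`. -/
lemma exists_conj_trace_pow {B : Matrix ι ι ℂ} (hB : B.PosSemidef) :
    ∃ Y : Matrix ι ι ℂ, Y.IsHermitian ∧ Y * Y = B ∧ ∀ (A : Matrix ι ι ℂ) {p : ℕ}, 1 ≤ p →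
      ((A * B) ^ p).trace = ((Y * A * Y) ^ p).trace := by
  obtain ⟨Y, hY, rfl⟩ := exists_sqrt hB
  refine ⟨Y, hY, rfl, fun A p hp => ?_⟩
  rw [← mul_assoc, trace_mul_pow_comm _ _ hp, mul_assoc]

lemma posSemidef_conj {κ : Type*} [Fintype κ] {A Y : Matrix κ κ ℂ} (hA : A.PosSemidef)
    (hY : Y.IsHermitian) :
    (Y * A * Y).PosSemidef := by
  have := hA.mul_mul_conjTranspose_same Y
  rwa [hY.eq] at this

lemma trace_mul_pow_eq_re {A B : Matrix ι ι ℂ} (hA : A.PosSemidef) (hB : B.PosSemidef)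
    {p : ℕ} (hp : 1 ≤ p) : ((A * B) ^ p).trace = ((((A * B) ^ p).trace.re : ℝ) : ℂ) := by
  obtain ⟨Y, hY, -, h⟩ := exists_conj_trace_pow hB
  rw [h A hp, ← trace_pow_eq_re (posSemidef_conj hA hY)]

lemma trace_mul_pow_re_nonneg {A B : Matrix ι ι ℂ} (hA : A.PosSemidef) (hB : B.PosSemidef)
    {p : ℕ} (hp : 1 ≤ p) : 0 ≤ ((A * B) ^ p).trace.re := by
  obtain ⟨Y, hY, -, h⟩ := exists_conj_trace_pow hB
  rw [h A hp]
  exact trace_pow_re_nonneg (posSemidef_conj hA hY) p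

/-- `(Re Tr (AB)^p)^(1/p)`. -/
noncomputable def traceNorm (p : ℕ) (A B : Matrix ι ι ℂ) : ℝ :=
  ((A * B) ^ p).trace.re ^ (1 / (p : ℝ))

lemma traceNorm_comm {p : ℕ} (hp : 1 ≤ p) (A B : Matrix ι ι ℂ) :
    traceNorm p A B = traceNorm p B A := by
  rw [traceNorm, trace_mul_pow_comm A B hp, traceNorm]

lemma traceNorm_nonneg {A B : Matrix ι ι ℂ} (hA : A.PosSemidef) (hB : B.PosSemidef)
    {p : ℕ} (hp : 1 ≤ p) : 0 ≤ traceNorm p A B :=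
  Real.rpow_nonneg (trace_mul_pow_re_nonneg hA hB hp) _

lemma traceNorm_pow {A B : Matrix ι ι ℂ} (hA : A.PosSemidef) (hB : B.PosSemidef)
    {p : ℕ} (hp : 1 ≤ p) : traceNorm p A B ^ p = ((A * B) ^ p).trace.re := by
  rw [traceNorm, one_div, Real.rpow_inv_natCast_pow (trace_mul_pow_re_nonneg hA hB hp) (by omega)]

/-- The square root Y depends on B only and YAY is linear in A, so this is the Schatten triangle
inequality. -/
lemma traceNorm_add_left_le {A A' B : Matrix ι ι ℂ} (hA : A.PosSemidef) (hA' : A'.PosSemidef)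
    (hB : B.PosSemidef) {p : ℕ} (hp : 1 ≤ p) :
    traceNorm p (A + A') B ≤ traceNorm p A B + traceNorm p A' B := by
  obtain ⟨Y, hY, -, h⟩ := exists_conj_trace_pow hB
  simp only [traceNorm, h _ hp]
  rw [mul_add, add_mul]
  exact trace_pow_rpow_add_le (posSemidef_conj hA hY) (posSemidef_conj hA' hY) hp

lemma traceNorm_le_add_left {A A' B : Matrix ι ι ℂ} (hA : A.PosSemidef) (hA' : A'.PosSemidef)
    (hB : B.PosSemidef) {p : ℕ} (hp : 1 ≤ p) :
    traceNorm p A B ≤ traceNorm p (A + A') B := by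
  obtain ⟨Y, hY, -, h⟩ := exists_conj_trace_pow hB
  simp only [traceNorm, h _ hp]
  refine Real.rpow_le_rpow (trace_pow_re_nonneg (posSemidef_conj hA hY) p) ?_ (by positivity)
  rw [mul_add, add_mul]
  exact trace_pow_mono (posSemidef_conj hA hY) (posSemidef_conj hA' hY) p

/-- The Schatten p-norm is at most the Schatten 1-norm, which has an explicit integral formula for
Toeplitz matrices. Used for distant dyadic pieces. -/
lemma traceNorm_le_trace_re {A B : Matrix ι ι ℂ} (hA : A.PosSemidef) (hB : B.PosSemidef)
    {p : ℕ} (hp : 1 ≤ p) : traceNorm p A B ≤ (A * B).trace.re := by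
  obtain ⟨Y, hY, -, h⟩ := exists_conj_trace_pow hB
  have h1 := h A (p := 1) le_rfl
  simp only [pow_one] at h1
  have hC := posSemidef_conj hA hY
  have h0 : 0 ≤ (Y * A * Y).trace.re := by simpa using trace_pow_re_nonneg hC 1
  rw [traceNorm, h A hp, h1]
  calc _ ≤ ((Y * A * Y).trace.re ^ p) ^ (1 / (p : ℝ)) :=
        Real.rpow_le_rpow (trace_pow_re_nonneg hC p) (trace_pow_le_trace_re_pow hC hp)
          (by positivity)
    _ = _ := by rw [one_div, Real.pow_rpow_inv_natCast h0 (by omega)]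

lemma trace_mul_re_le {A B : Matrix ι ι ℂ} (hA : A.PosSemidef) {b : ℝ}
    (hb : ((b : ℂ) • (1 : Matrix ι ι ℂ) - B).PosSemidef) :
    (A * B).trace.re ≤ b * A.trace.re := by
  have h := trace_mul_pow_re_nonneg hA hb (p := 1) le_rfl
  rw [pow_one, mul_sub, Matrix.trace_sub, mul_smul_comm, mul_one, Matrix.trace_smul, Complex.sub_re]
    at h
  simp at h
  linarith

lemma traceNorm_le_of_le {A B : Matrix ι ι ℂ} (hA : A.PosSemidef) (hB : B.PosSemidef) {a b : ℝ}
    (ha0 : 0 ≤ a) (hb0 : 0 ≤ b) (ha : ((a : ℂ) • (1 : Matrix ι ι ℂ) - A).PosSemidef)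
    (hb : ((b : ℂ) • (1 : Matrix ι ι ℂ) - B).PosSemidef) {p : ℕ} (hp : 1 ≤ p) :
    traceNorm p A B ≤ ((a * b) ^ (p - 1) * (b * A.trace.re)) ^ (1 / (p : ℝ)) := by
  obtain ⟨Y, hY, hYB, h⟩ := exists_conj_trace_pow hB
  have hC := posSemidef_conj hA hY
  -- Since Y² = B, ab - YAY = Y(a - A)Y + a(b - B).
  have hle : (((a * b : ℝ) : ℂ) • (1 : Matrix ι ι ℂ) - Y * A * Y).PosSemidef := by
    have h1 := (posSemidef_conj ha hY).add (hb.smul (a := (a : ℂ)) (by exact_mod_cast ha0))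
    convert h1 using 1
    rw [mul_sub, sub_mul, mul_smul_comm, mul_one, smul_mul_assoc, hYB, smul_sub, smul_smul]
    push_cast
    abel
  rw [traceNorm, h A hp]
  refine Real.rpow_le_rpow (trace_pow_re_nonneg hC p) ?_ (by positivity)
  refine (trace_pow_le_of_le hC hle hp).trans ?_
  refine mul_le_mul_of_nonneg_left ?_ (by positivity)
  have h1 := h A (p := 1) le_rfl
  simp only [pow_one] at h1
  rw [← h1]
  exact trace_mul_re_le hA hb

end Matrices

/-! ### Toeplitz matrices of real symbols and their quadratic forms. -/

/-- Lebesgue measure on `[-π, π]`. -/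
noncomputable abbrev angleMeasure : Measure ℝ := volume.restrict (Set.Icc (-Real.pi) Real.pi)

/-- The character `x ↦ e^{imx}`. -/
noncomputable def chr (m : ℤ) (x : ℝ) : ℂ := Complex.exp (Complex.I * (m : ℂ) * (x : ℂ))

/-- The Toeplitz matrix of a real function. -/
noncomputable def toep (n : ℕ) (f : ℝ → ℝ) : Matrix (Fin n) (Fin n) ℂ :=
  Matrix.of fun i j => ∫ x, chr (((i : ℕ) : ℤ) - ((j : ℕ) : ℤ)) x * (f x : ℂ) ∂angleMeasure

/-- The trigonometric polynomial with coefficients `z`. -/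
noncomputable def trig {n : ℕ} (z : Fin n → ℂ) (x : ℝ) : ℂ :=
  ∑ j, z j * chr (-((j : ℕ) : ℤ)) x

lemma norm_chr (m : ℤ) (x : ℝ) : ‖chr m x‖ = 1 := by
  rw [chr]
  have : Complex.I * (m : ℂ) * (x : ℂ) = ((m * x : ℝ) : ℂ) * Complex.I := by push_cast; ring
  rw [this, Complex.norm_exp_ofReal_mul_I]

lemma continuous_chr (m : ℤ) : Continuous (chr m) := by
  unfold chr; fun_prop

lemma chr_add (m k : ℤ) (x : ℝ) : chr (m + k) x = chr m x * chr k x := by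
  simp only [chr]; rw [← Complex.exp_add]; congr 1; push_cast; ring

lemma chr_sub_right (m : ℤ) (x y : ℝ) : chr m (x - y) = chr m x * chr (-m) y := by
  simp only [chr]; rw [← Complex.exp_add]; congr 1; push_cast; ring

lemma star_chr (m : ℤ) (x : ℝ) : star (chr m x) = chr (-m) x := by
  simp only [chr, Complex.star_def]
  rw [← Complex.exp_conj]
  simp

lemma chr_zero (x : ℝ) : chr 0 x = 1 := by simp [chr]

lemma continuous_trig {n : ℕ} (z : Fin n → ℂ) : Continuous (trig z) := by
  unfold trig
  exact continuous_finsetSum _ fun j _ => continuous_const.mul (continuous_chr _)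

lemma norm_trig_le {n : ℕ} (z : Fin n → ℂ) (x : ℝ) : ‖trig z x‖ ≤ ∑ j, ‖z j‖ := by
  unfold trig
  refine (norm_sum_le _ _).trans (le_of_eq ?_)
  simp [norm_chr]

lemma integrable_chr_mul {f : ℝ → ℂ} (hf : Integrable f angleMeasure) (m : ℤ) :
    Integrable (fun x => chr m x * f x) angleMeasure :=
  hf.bdd_mul (continuous_chr m).aestronglyMeasurable
    (Eventually.of_forall fun x => (norm_chr m x).le)

lemma integrable_chr_mul_ofReal {f : ℝ → ℝ} (hf : Integrable f angleMeasure) (m : ℤ) :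
    Integrable (fun x => chr m x * (f x : ℂ)) angleMeasure :=
  integrable_chr_mul hf.ofReal m

lemma toep_congr_ae {f g : ℝ → ℝ} (h : f =ᵐ[angleMeasure] g) (n : ℕ) : toep n f = toep n g := by
  ext i j
  refine integral_congr_ae ?_
  filter_upwards [h] with x hx
  rw [hx]

lemma toep_add {f g : ℝ → ℝ} (hf : Integrable f angleMeasure) (hg : Integrable g angleMeasure)
    (n : ℕ) : toep n (fun x => f x + g x) = toep n f + toep n g := by
  ext i j
  simp only [toep, Matrix.of_apply, Matrix.add_apply]
  rw [← integral_add (integrable_chr_mul_ofReal hf _) (integrable_chr_mul_ofReal hg _)]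
  refine integral_congr_ae (Eventually.of_forall fun x => ?_)
  simp only [Complex.ofReal_add]; ring

lemma toep_const_mul (c : ℝ) (f : ℝ → ℝ) (n : ℕ) :
    toep n (fun x => c * f x) = (c : ℂ) • toep n f := by
  ext i j
  simp only [toep, Matrix.of_apply, Matrix.smul_apply, smul_eq_mul]
  rw [← integral_const_mul]
  refine integral_congr_ae (Eventually.of_forall fun x => ?_)
  simp only [Complex.ofReal_mul]; ring

lemma toep_sub {f g : ℝ → ℝ} (hf : Integrable f angleMeasure) (hg : Integrable g angleMeasure)
    (n : ℕ) : toep n (fun x => f x - g x) = toep n f - toep n g := by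
  ext i j
  simp only [toep, Matrix.of_apply, Matrix.sub_apply]
  rw [← integral_sub (integrable_chr_mul_ofReal hf _) (integrable_chr_mul_ofReal hg _)]
  refine integral_congr_ae (Eventually.of_forall fun x => ?_)
  simp only [Complex.ofReal_sub]; ring

lemma toep_finset_sum {κ : Type*} (s : Finset κ) {f : κ → ℝ → ℝ}
    (hf : ∀ k ∈ s, Integrable (f k) angleMeasure) (n : ℕ) :
    toep n (fun x => ∑ k ∈ s, f k x) = ∑ k ∈ s, toep n (f k) := by
  classical
  induction s using Finset.induction_on with
  | empty => ext i j; simp [toep]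
  | insert a s ha ih =>
    simp only [Finset.sum_insert ha]
    rw [toep_add (hf a (by simp)) (integrable_finsetSum _ fun k hk => hf k (by simp [hk])),
      ih fun k hk => hf k (by simp [hk])]

lemma angleMeasure_integral_one : ∫ _, (1 : ℝ) ∂angleMeasure = 2 * Real.pi := by
  simp [Real.pi_pos.le, Measure.real]
  ring

lemma integral_chr (m : ℤ) :
    ∫ x, chr m x ∂angleMeasure = if m = 0 then ((2 * Real.pi : ℝ) : ℂ) else 0 := by
  split_ifs with hm
  · subst hm
    simp only [chr_zero]
    rw [← angleMeasure_integral_one, ← integral_complex_ofReal]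
    simp
  · rw [integral_Icc_eq_integral_Ioc, ← intervalIntegral.integral_of_le
      (by linarith [Real.pi_pos])]
    have hc : Complex.I * (m : ℂ) ≠ 0 := mul_ne_zero Complex.I_ne_zero (by exact_mod_cast hm)
    simp only [chr]
    rw [integral_exp_mul_complex hc, div_eq_zero_iff]
    left
    rw [sub_eq_zero, Complex.exp_eq_exp_iff_exists_int]
    exact ⟨m, by push_cast; ring⟩

lemma toep_const (c : ℝ) (n : ℕ) :
    toep n (fun _ => c) = ((2 * Real.pi * c : ℝ) : ℂ) • (1 : Matrix (Fin n) (Fin n) ℂ) := by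
  ext i j
  simp only [toep, Matrix.of_apply, Matrix.smul_apply, smul_eq_mul]
  rw [integral_mul_const, integral_chr]
  by_cases h : i = j
  · subst h; simp
  · have : ((i : ℕ) : ℤ) - ((j : ℕ) : ℤ) ≠ 0 := by
      intro h'; exact h (Fin.ext (by omega))
    simp [h, this]

lemma isHermitian_toep (n : ℕ) (f : ℝ → ℝ) : (toep n f).IsHermitian := by
  ext i j
  simp only [toep, Matrix.conjTranspose_apply, Matrix.of_apply, Complex.star_def]
  rw [← integral_conj]
  refine integral_congr_ae (Eventually.of_forall fun x => ?_)
  simp only [map_mul, Complex.conj_ofReal]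
  rw [← Complex.star_def, star_chr]
  ring_nf

/-- The matrix is a compressed multiplication operator: form the trigonometric polynomial of z,
multiply by f, and read off n Fourier coefficients. -/
lemma toep_mulVec {n : ℕ} {f : ℝ → ℝ} (hf : Integrable f angleMeasure) (z : Fin n → ℂ)
    (i : Fin n) : (toep n f).mulVec z i =
      ∫ x, chr ((i : ℕ) : ℤ) x * (f x * trig z x) ∂angleMeasure := by
  simp only [Matrix.mulVec, dotProduct, toep, Matrix.of_apply, trig]
  simp_rw [← integral_mul_const]
  rw [← integral_finsetSum _ fun j _ => (integrable_chr_mul_ofReal hf _).mul_const _]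
  refine integral_congr_ae (Eventually.of_forall fun x => ?_)
  simp only [Finset.mul_sum]
  refine Finset.sum_congr rfl fun j _ => ?_
  rw [sub_eq_add_neg, chr_add]; ring

lemma integrable_mul_trig {n : ℕ} {f : ℝ → ℂ} (hf : Integrable f angleMeasure) (z : Fin n → ℂ) :
    Integrable (fun x => f x * trig z x) angleMeasure :=
  (hf.bdd_mul (continuous_trig z).aestronglyMeasurable
    (Eventually.of_forall fun x => norm_trig_le z x)).congr
    (Eventually.of_forall fun _ => mul_comm _ _)

lemma star_trig {n : ℕ} (z : Fin n → ℂ) (x : ℝ) :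
    ∑ i, star (z i) * chr ((i : ℕ) : ℤ) x = star (trig z x) := by
  simp only [trig, star_sum, star_mul, star_chr, neg_neg]
  exact Finset.sum_congr rfl fun i _ => mul_comm _ _

/-- The source of all positivity: pointwise inequalities between symbols become Loewner inequalities
between matrices. -/
lemma quadForm_toep {n : ℕ} {f : ℝ → ℝ} (hf : Integrable f angleMeasure) (z : Fin n → ℂ) :
    star z ⬝ᵥ (toep n f).mulVec z = ((∫ x, f x * ‖trig z x‖ ^ 2 ∂angleMeasure : ℝ) : ℂ) := by
  simp only [dotProduct, toep_mulVec hf, Pi.star_apply]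
  simp_rw [← integral_const_mul]
  have hint : ∀ i : Fin n, Integrable (fun x =>
      star (z i) * (chr ((i : ℕ) : ℤ) x * (f x * trig z x))) angleMeasure :=
    fun i => (integrable_chr_mul (integrable_mul_trig hf.ofReal z) _).const_mul _
  rw [← integral_finsetSum _ fun i _ => hint i, ← integral_complex_ofReal]
  refine integral_congr_ae (Eventually.of_forall fun x => ?_)
  simp only
  calc ∑ i : Fin n, star (z i) * (chr ((i : ℕ) : ℤ) x * (f x * trig z x))
      = (∑ i : Fin n, star (z i) * chr ((i : ℕ) : ℤ) x) * (f x * trig z x) := by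
        rw [Finset.sum_mul]; exact Finset.sum_congr rfl fun i _ => by ring
    _ = f x * (star (trig z x) * trig z x) := by rw [star_trig]; ring
    _ = _ := by
      rw [Complex.star_def, mul_comm (starRingEnd ℂ _), Complex.mul_conj,
        Complex.normSq_eq_norm_sq]
      push_cast; rfl

lemma posSemidef_toep {f : ℝ → ℝ} (hf : Integrable f angleMeasure)
    (h0 : 0 ≤ᵐ[angleMeasure] f) (n : ℕ) : (toep n f).PosSemidef := by
  refine Matrix.PosSemidef.of_dotProduct_mulVec_nonneg (isHermitian_toep n f) fun z => ?_
  rw [quadForm_toep hf]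
  have : 0 ≤ ∫ x, f x * ‖trig z x‖ ^ 2 ∂angleMeasure := by
    refine integral_nonneg_of_ae ?_
    filter_upwards [h0] with x hx
    exact mul_nonneg hx (sq_nonneg _)
  exact_mod_cast this

lemma trace_toep (n : ℕ) (f : ℝ → ℝ) :
    (toep n f).trace = ((n * ∫ x, f x ∂angleMeasure : ℝ) : ℂ) := by
  simp only [Matrix.trace, Matrix.diag, toep, Matrix.of_apply, sub_self, chr_zero, one_mul]
  rw [integral_complex_ofReal]
  simp

/-- If `f ≤ M` then `2πM - S_n(f)` is positive semidefinite. -/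
lemma posSemidef_smul_one_sub_toep {f : ℝ → ℝ} (hf : Integrable f angleMeasure) {M : ℝ}
    (hM : ∀ᵐ x ∂angleMeasure, f x ≤ M) (n : ℕ) :
    (((2 * Real.pi * M : ℝ) : ℂ) • (1 : Matrix (Fin n) (Fin n) ℂ) - toep n f).PosSemidef := by
  rw [← toep_const, ← toep_sub (integrable_const M) hf]
  refine posSemidef_toep ((integrable_const M).sub hf) ?_ n
  filter_upwards [hM] with x hx
  simpa using hx

/-- Cauchy–Schwarz. It yields an operator bound in terms of the mass of f, needed where f may be
unbounded. -/
lemma trig_sq_le {n : ℕ} (z : Fin n → ℂ) (x : ℝ) : ‖trig z x‖ ^ 2 ≤ n * ∑ j, ‖z j‖ ^ 2 := by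
  calc ‖trig z x‖ ^ 2 ≤ (∑ j, ‖z j‖) ^ 2 := pow_le_pow_left₀ (norm_nonneg _) (norm_trig_le z x) 2
    _ ≤ _ := by
      have := sq_sum_le_card_mul_sum_sq (s := (Finset.univ : Finset (Fin n))) (f := fun j => ‖z j‖)
      simpa using this

/-- If `f ≥ 0` then `n ∫ f - S_n(f)` is positive semidefinite. -/
lemma posSemidef_integral_smul_one_sub_toep {f : ℝ → ℝ} (hf : Integrable f angleMeasure)
    (h0 : 0 ≤ᵐ[angleMeasure] f) (n : ℕ) :
    (((n * ∫ x, f x ∂angleMeasure : ℝ) : ℂ) • (1 : Matrix (Fin n) (Fin n) ℂ)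
      - toep n f).PosSemidef := by
  refine Matrix.PosSemidef.of_dotProduct_mulVec_nonneg ?_ fun z => ?_
  · refine Matrix.IsHermitian.sub ?_ (isHermitian_toep n f)
    rw [Matrix.IsHermitian, Matrix.conjTranspose_smul, Matrix.conjTranspose_one, Complex.star_def,
      Complex.conj_ofReal]
  · rw [Matrix.sub_mulVec, dotProduct_sub, quadForm_toep hf, Matrix.smul_mulVec,
      Matrix.one_mulVec, dotProduct_smul]
    have hz : star z ⬝ᵥ z = ((∑ j, ‖z j‖ ^ 2 : ℝ) : ℂ) := by
      simp only [dotProduct, Pi.star_apply, Complex.star_def]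
      push_cast
      refine Finset.sum_congr rfl fun j _ => ?_
      rw [mul_comm, Complex.mul_conj, Complex.normSq_eq_norm_sq]; push_cast; rfl
    have hle : ∫ x, f x * ‖trig z x‖ ^ 2 ∂angleMeasure ≤
        (n * ∫ x, f x ∂angleMeasure) * ∑ j, ‖z j‖ ^ 2 := by
      calc ∫ x, f x * ‖trig z x‖ ^ 2 ∂angleMeasure
          ≤ ∫ x, f x * (n * ∑ j, ‖z j‖ ^ 2) ∂angleMeasure := by
            refine integral_mono_of_nonneg ?_ (hf.mul_const _) ?_
            · filter_upwards [h0] with x hx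
              exact mul_nonneg hx (sq_nonneg _)
            · filter_upwards [h0] with x hx
              exact mul_le_mul_of_nonneg_left (trig_sq_le z x) hx
        _ = _ := by rw [integral_mul_const]; ring
    rw [hz, smul_eq_mul, sub_nonneg]
    exact_mod_cast hle

/-- The Toeplitz matrix is ∫ f(x) e_x e_x* dx with e_x the vector of characters, and Tr(e_x e_x* B)
= e_x* B e_x. -/
lemma trace_toep_mul {n : ℕ} {f : ℝ → ℝ} (hf : Integrable f angleMeasure)
    (B : Matrix (Fin n) (Fin n) ℂ) :
    (toep n f * B).trace = ∫ x, (f x : ℂ) *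
      (star (fun j : Fin n => chr ((j : ℕ) : ℤ) x) ⬝ᵥ
        B.mulVec (fun j : Fin n => chr ((j : ℕ) : ℤ) x)) ∂angleMeasure := by
  simp only [Matrix.trace, Matrix.diag, Matrix.mul_apply, toep, Matrix.of_apply]
  simp_rw [← integral_mul_const]
  have hint : ∀ i j : Fin n, Integrable (fun x =>
      chr (((i : ℕ) : ℤ) - ((j : ℕ) : ℤ)) x * (f x : ℂ) * B j i) angleMeasure :=
    fun i j => (integrable_chr_mul_ofReal hf _).mul_const _
  simp_rw [← integral_finsetSum _ fun j _ => hint _ j]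
  rw [← integral_finsetSum _ fun i _ => integrable_finsetSum _ fun j _ => hint i j]
  refine integral_congr_ae (Eventually.of_forall fun x => ?_)
  simp only [dotProduct, Matrix.mulVec, Pi.star_apply, star_chr, Finset.mul_sum]
  rw [Finset.sum_comm]
  refine Finset.sum_congr rfl fun i _ => Finset.sum_congr rfl fun j _ => ?_
  rw [sub_eq_add_neg, chr_add]; ring

/-! ### The Dirichlet kernel and traces of products. -/

/-- The Dirichlet kernel. -/
noncomputable def dirichlet (n : ℕ) (x : ℝ) : ℂ := ∑ j : Fin n, chr ((j : ℕ) : ℤ) x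

/-- The trace equals ∬ f(x) g(y) |D_n(x-y)|² dx dy, so the kernel need only be bounded where f and g
are both nonzero. -/
lemma trace_toep_mul_toep_le {n : ℕ} {f g : ℝ → ℝ} (hf : Integrable f angleMeasure)
    (hg : Integrable g angleMeasure) (hf0 : 0 ≤ᵐ[angleMeasure] f) (hg0 : 0 ≤ᵐ[angleMeasure] g)
    {K : ℝ}
    (hK : ∀ᵐ x ∂angleMeasure, f x ≠ 0 → ∀ᵐ y ∂angleMeasure, g y ≠ 0 →
      ‖dirichlet n (x - y)‖ ^ 2 ≤ K) :
    (toep n f * toep n g).trace.re ≤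
      K * (∫ x, f x ∂angleMeasure) * ∫ y, g y ∂angleMeasure := by
  rw [trace_toep_mul hf]
  simp_rw [quadForm_toep hg, ← Complex.ofReal_mul]
  rw [integral_complex_ofReal, Complex.ofReal_re]
  have hle : ∀ᵐ x ∂angleMeasure,
      f x * (∫ y, g y * ‖trig (fun j : Fin n => chr ((j : ℕ) : ℤ) x) y‖ ^ 2 ∂angleMeasure) ≤
        f x * (K * ∫ y, g y ∂angleMeasure) := by
    filter_upwards [hK, hf0] with x hx hx0
    by_cases hfx : f x = 0
    · simp [hfx]
    · refine mul_le_mul_of_nonneg_left ?_ hx0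
      rw [← integral_const_mul]
      refine integral_mono_of_nonneg ?_ (hg.const_mul K) ?_
      · filter_upwards [hg0] with y hy
        exact mul_nonneg hy (sq_nonneg _)
      · filter_upwards [hg0, hx hfx] with y hy hxy
        by_cases hgy : g y = 0
        · simp [hgy]
        · have := hxy hgy
          have htr : trig (fun j : Fin n => chr ((j : ℕ) : ℤ) x) y = dirichlet n (x - y) := by
            simp only [trig, dirichlet, chr_sub_right]
          simp only [htr]
          rw [mul_comm K]
          exact mul_le_mul_of_nonneg_left this hy
  calc _ ≤ ∫ x, f x * (K * ∫ y, g y ∂angleMeasure) ∂angleMeasure := by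
        refine integral_mono_of_nonneg ?_ (hf.mul_const _) hle
        filter_upwards [hf0] with _ hx
        refine mul_nonneg hx (integral_nonneg_of_ae ?_)
        filter_upwards [hg0] with y hy
        exact mul_nonneg hy (sq_nonneg _)
    _ = _ := by rw [integral_mul_const]; ring

lemma dirichlet_mul (n : ℕ) (x : ℝ) : dirichlet n x * (chr 1 x - 1) = chr n x - 1 := by
  have h : ∀ j : ℕ, chr (j : ℤ) x = chr 1 x ^ j := by
    intro j
    induction j with
    | zero => simp [chr_zero]
    | succ j ih => rw [pow_succ, ← ih, ← chr_add]; push_cast; rfl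
  rw [dirichlet, Fin.sum_univ_eq_sum_range (fun j => chr (j : ℤ) x) n, h n]
  simp_rw [h]
  exact geom_sum_mul _ _

lemma norm_chr_one_sub_one (x : ℝ) : ‖chr 1 x - 1‖ = 2 * |Real.sin (x / 2)| := by
  have := Complex.norm_exp_I_mul_ofReal_sub_one x
  rw [chr]
  simp only [Int.cast_one, mul_one]
  rw [this, norm_mul]; simp

/-- Jordan's inequality, applied to t or to π - t, because t may reach 3π/4. -/
lemma le_sin_of_far {t r : ℝ} (hr : 0 ≤ r) (hrpi : r ≤ Real.pi) (h1 : r / 4 ≤ t)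
    (h2 : t ≤ 3 * r / 4) : r / (2 * Real.pi) ≤ Real.sin t := by
  have hpi := Real.pi_pos
  rcases le_total t (Real.pi / 2) with h | h
  · refine le_trans ?_ (Real.mul_le_sin (by linarith) h)
    rw [div_mul_eq_mul_div, div_le_div_iff₀ (by positivity) hpi]
    nlinarith
  · rw [← Real.sin_pi_sub]
    refine le_trans ?_ (Real.mul_le_sin (by linarith) (by linarith))
    rw [div_mul_eq_mul_div, div_le_div_iff₀ (by positivity) hpi]
    nlinarith

/-- Summing the geometric series leaves the denominator 2|sin((x-y)/2)|. Here |x-y| lies between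
|x|/2 and 3|x|/2 ≤ 3π/2, hence stays away from the other zero of the denominator, at 2π. -/
lemma norm_dirichlet_le_of_far (n : ℕ) {x y : ℝ} (hx : |x| ≤ Real.pi) (hx0 : x ≠ 0)
    (hy : |y| ≤ |x| / 2) : ‖dirichlet n (x - y)‖ ≤ 2 * Real.pi / |x| := by
  have hpi := Real.pi_pos
  have hxp : 0 < |x| := abs_pos.2 hx0
  have h1 : |x| / Real.pi ≤ ‖chr 1 (x - y) - 1‖ := by
    rw [norm_chr_one_sub_one]
    have hlow : |x| / 2 ≤ |x - y| := by
      have := abs_sub_abs_le_abs_sub x y; linarith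
    have hup : |x - y| ≤ 3 * |x| / 2 := by
      have := abs_sub x y; linarith
    have hs : |Real.sin ((x - y) / 2)| = |Real.sin (|x - y| / 2)| := by
      rcases abs_choice (x - y) with h | h
      · rw [h]
      · rw [h, neg_div, Real.sin_neg, abs_neg]
    have := le_sin_of_far (t := |x - y| / 2) hxp.le hx (by linarith) (by linarith)
    rw [hs]
    have h3 := le_abs_self (Real.sin (|x - y| / 2))
    have h4 : |x| / Real.pi = 2 * (|x| / (2 * Real.pi)) := by field_simp
    linarith
  have h2 : ‖dirichlet n (x - y)‖ * ‖chr 1 (x - y) - 1‖ ≤ 2 := by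
    rw [← norm_mul, dirichlet_mul]
    refine (norm_sub_le _ _).trans ?_
    rw [norm_chr]; norm_num
  have h3 : ‖dirichlet n (x - y)‖ * (|x| / Real.pi) ≤ 2 :=
    (mul_le_mul_of_nonneg_left h1 (norm_nonneg _)).trans h2
  rw [le_div_iff₀ hxp]
  rw [← mul_div_assoc, div_le_iff₀ hpi] at h3
  exact h3

/-! ### Bessel's inequality. -/

section Bessel

lemma integral_norm_trig_sq {n : ℕ} (w : Fin n → ℂ) :
    ∫ x, ‖trig w x‖ ^ 2 ∂angleMeasure = 2 * Real.pi * ∑ j, ‖w j‖ ^ 2 := by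
  have h := quadForm_toep (integrable_const (1 : ℝ)) w
  rw [toep_const, Matrix.smul_mulVec, Matrix.one_mulVec, dotProduct_smul] at h
  have hz : star w ⬝ᵥ w = ((∑ j, ‖w j‖ ^ 2 : ℝ) : ℂ) := by
    simp only [dotProduct, Pi.star_apply, Complex.star_def]
    push_cast
    refine Finset.sum_congr rfl fun j _ => ?_
    rw [mul_comm, Complex.mul_conj, Complex.normSq_eq_norm_sq]; push_cast; rfl
  rw [hz, smul_eq_mul, ← Complex.ofReal_mul] at h
  have := Complex.ofReal_injective h
  simp only [one_mul, mul_one] at this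
  exact this.symm

lemma integrable_norm_sq {φ : ℝ → ℂ} (hφ : MemLp φ ⊤ angleMeasure) :
    Integrable (fun x => ‖φ x‖ ^ 2) angleMeasure :=
  (hφ.mono_exponent le_top).integrable_norm_pow (p := 2) (by norm_num)

lemma memLp_trig {n : ℕ} (w : Fin n → ℂ) : MemLp (trig w) ⊤ angleMeasure :=
  memLp_top_of_bound (continuous_trig w).aestronglyMeasurable _
    (Eventually.of_forall fun x => norm_trig_le w x)

lemma memLp_chr (m : ℤ) : MemLp (chr m) ⊤ angleMeasure :=
  memLp_top_of_bound (continuous_chr m).aestronglyMeasurable 1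
    (Eventually.of_forall fun x => (norm_chr m x).le)

lemma memLp_top_mul {φ χ : ℝ → ℂ} (hφ : MemLp φ ⊤ angleMeasure) (hχ : MemLp χ ⊤ angleMeasure) :
    MemLp (fun x => φ x * χ x) ⊤ angleMeasure := hχ.mul hφ

lemma memLp_top_mul_real {φ χ : ℝ → ℝ} (hφ : MemLp φ ⊤ angleMeasure)
    (hχ : MemLp χ ⊤ angleMeasure) : MemLp (fun x => φ x * χ x) ⊤ angleMeasure := hχ.mul hφ

lemma integrable_of_memLp_top {E : Type*} [NormedAddCommGroup E] {φ : ℝ → E}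
    (hφ : MemLp φ ⊤ angleMeasure) : Integrable φ angleMeasure :=
  hφ.integrable le_top

/-- The mean-square distance of `2πφ` to the partial sum of its Fourier series. -/
lemma integral_norm_trig_sub_sq {n : ℕ} {φ : ℝ → ℂ} (hφ : MemLp φ ⊤ angleMeasure)
    {w : Fin n → ℂ} (hw : ∀ l, w l = ∫ x, chr ((l : ℕ) : ℤ) x * φ x ∂angleMeasure) :
    ∫ x, ‖trig w x - 2 * Real.pi * φ x‖ ^ 2 ∂angleMeasure =
      2 * Real.pi * (2 * Real.pi * ∫ x, ‖φ x‖ ^ 2 ∂angleMeasure - ∑ l, ‖w l‖ ^ 2) := by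
  -- The partial sum is an orthogonal projection up to scale, so the cross term carries the same
  -- energy as the coefficients.
  have hcross : ∫ x, star (trig w x) * φ x ∂angleMeasure = ((∑ l, ‖w l‖ ^ 2 : ℝ) : ℂ) := by
    have hint : ∀ l : Fin n, Integrable (fun x => star (w l) * (chr ((l : ℕ) : ℤ) x * φ x))
        angleMeasure := fun l => (integrable_chr_mul (integrable_of_memLp_top hφ) _).const_mul _
    calc ∫ x, star (trig w x) * φ x ∂angleMeasure
        = ∫ x, ∑ l : Fin n, star (w l) * (chr ((l : ℕ) : ℤ) x * φ x) ∂angleMeasure := by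
          refine integral_congr_ae (Eventually.of_forall fun x => ?_)
          simp only [← star_trig, Finset.sum_mul]
          exact Finset.sum_congr rfl fun l _ => by ring
      _ = ∑ l : Fin n, star (w l) * w l := by
          rw [integral_finsetSum _ fun l _ => hint l]
          refine Finset.sum_congr rfl fun l _ => ?_
          rw [integral_const_mul, ← hw l]
      _ = _ := by
          push_cast
          refine Finset.sum_congr rfl fun l _ => ?_
          rw [Complex.star_def, mul_comm, Complex.mul_conj, Complex.normSq_eq_norm_sq]
          push_cast; rfl
  have hpt : ∀ x, ‖trig w x - 2 * Real.pi * φ x‖ ^ 2 =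
      ‖trig w x‖ ^ 2 + (4 * Real.pi ^ 2 * ‖φ x‖ ^ 2 -
        4 * Real.pi * (star (trig w x) * φ x).re) := by
    intro x
    rw [← Complex.normSq_eq_norm_sq, ← Complex.normSq_eq_norm_sq, ← Complex.normSq_eq_norm_sq]
    simp [Complex.normSq_apply]
    ring
  have hi1 := integrable_norm_sq (memLp_trig w)
  have hi2 := integrable_norm_sq hφ
  have hstar : MemLp (fun x => star (trig w x)) ⊤ angleMeasure := by
    refine memLp_top_of_bound ?_ (∑ j, ‖w j‖) (Eventually.of_forall fun x => ?_)
    · exact (continuous_star.comp (continuous_trig w)).aestronglyMeasurable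
    · rw [norm_star]; exact norm_trig_le w x
  have hi3 : Integrable (fun x => star (trig w x) * φ x) angleMeasure :=
    integrable_of_memLp_top (memLp_top_mul hstar hφ)
  have hi4 : Integrable (fun x => (star (trig w x) * φ x).re) angleMeasure := hi3.re
  have hre : ∫ x, (star (trig w x) * φ x).re ∂angleMeasure = ∑ l, ‖w l‖ ^ 2 := by
    have := integral_re hi3
    simp only [RCLike.re_eq_complex_re] at this
    rw [this, hcross, Complex.ofReal_re]
  have hi5 : Integrable (fun x => 4 * Real.pi ^ 2 * ‖φ x‖ ^ 2 -
      4 * Real.pi * (star (trig w x) * φ x).re) angleMeasure :=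
    (hi2.const_mul _).sub (hi4.const_mul _)
  simp_rw [hpt]
  rw [integral_add hi1 hi5, integral_sub (hi2.const_mul _) (hi4.const_mul _), integral_const_mul,
    integral_const_mul, hre,
    integral_norm_trig_sq]
  ring

lemma bessel {n : ℕ} {φ : ℝ → ℂ} (hφ : MemLp φ ⊤ angleMeasure) :
    ∑ l : Fin n, ‖∫ x, chr ((l : ℕ) : ℤ) x * φ x ∂angleMeasure‖ ^ 2 ≤
      2 * Real.pi * ∫ x, ‖φ x‖ ^ 2 ∂angleMeasure := by
  have h := integral_norm_trig_sub_sq (n := n) hφ (fun _ => rfl)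
  have h0 : 0 ≤ ∫ x, ‖trig (fun l : Fin n => ∫ x, chr ((l : ℕ) : ℤ) x * φ x ∂angleMeasure) x
      - 2 * Real.pi * φ x‖ ^ 2 ∂angleMeasure := integral_nonneg fun x => sq_nonneg _
  rw [h] at h0
  have := nonneg_of_mul_nonneg_right h0 (by positivity [Real.pi_pos])
  linarith

end Bessel

/-! ### Frobenius estimates for products of Toeplitz matrices. -/

/-- The square of the Frobenius norm. -/
noncomputable def frobSq {n : ℕ} (M : Matrix (Fin n) (Fin n) ℂ) : ℝ := ∑ j, ∑ i, ‖M i j‖ ^ 2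

lemma frobSq_nonneg {n : ℕ} (M : Matrix (Fin n) (Fin n) ℂ) : 0 ≤ frobSq M :=
  Finset.sum_nonneg fun _ _ => Finset.sum_nonneg fun _ _ => sq_nonneg _

lemma frobSq_add_le {n : ℕ} (M N : Matrix (Fin n) (Fin n) ℂ) :
    frobSq (M + N) ≤ 2 * frobSq M + 2 * frobSq N := by
  simp only [frobSq, Finset.mul_sum, ← Finset.sum_add_distrib]
  refine Finset.sum_le_sum fun j _ => Finset.sum_le_sum fun i _ => ?_
  rw [Matrix.add_apply]
  have h1 := norm_add_le (M i j) (N i j)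
  have h2 := norm_nonneg (M i j + N i j)
  nlinarith [sq_nonneg (‖M i j‖ - ‖N i j‖)]

lemma norm_trace_sq_le {n : ℕ} (M : Matrix (Fin n) (Fin n) ℂ) :
    ‖M.trace‖ ^ 2 ≤ n * frobSq M := by
  calc ‖M.trace‖ ^ 2 ≤ (∑ i, ‖M i i‖) ^ 2 :=
        pow_le_pow_left₀ (norm_nonneg _) (norm_sum_le _ _) 2
    _ ≤ n * ∑ i, ‖M i i‖ ^ 2 := by
        have := sq_sum_le_card_mul_sum_sq (s := (Finset.univ : Finset (Fin n)))
          (f := fun j => ‖M j j‖)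
        simpa using this
    _ ≤ n * frobSq M := by
        refine mul_le_mul_of_nonneg_left (Finset.sum_le_sum fun j _ => ?_) (by positivity)
        exact Finset.single_le_sum (f := fun i => ‖M i j‖ ^ 2) (fun i _ => sq_nonneg _)
          (Finset.mem_univ j)

lemma sum_norm_integral_sq_le {n : ℕ} {f : ℝ → ℝ} (hf : MemLp f ⊤ angleMeasure) {M : ℝ}
    (hM : ∀ᵐ x ∂angleMeasure, |f x| ≤ M) {φ : ℝ → ℂ} (hφ : MemLp φ ⊤ angleMeasure) :
    ∑ l : Fin n, ‖∫ x, chr ((l : ℕ) : ℤ) x * (f x * φ x) ∂angleMeasure‖ ^ 2 ≤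
      2 * Real.pi * (M ^ 2 * ∫ x, ‖φ x‖ ^ 2 ∂angleMeasure) := by
  refine (bessel (memLp_top_mul hf.ofReal hφ)).trans ?_
  refine mul_le_mul_of_nonneg_left ?_ (by positivity [Real.pi_pos])
  rw [← integral_const_mul]
  refine integral_mono_of_nonneg (Eventually.of_forall fun x => sq_nonneg _)
    ((integrable_norm_sq hφ).const_mul _) ?_
  filter_upwards [hM] with x hx
  simp only [norm_mul, mul_pow]
  refine mul_le_mul_of_nonneg_right ?_ (sq_nonneg _)
  have h : ‖((f x : ℝ) : ℂ)‖ = |f x| := by rw [Complex.norm_real, Real.norm_eq_abs]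
  exact pow_le_pow_left₀ (norm_nonneg _) (h.trans_le hx) 2

/-- Bessel, applied column by column: multiplication by the Toeplitz matrix has operator norm at
most 2πM. -/
lemma frobSq_toep_mul_le {n : ℕ} {f : ℝ → ℝ} (hf : MemLp f ⊤ angleMeasure) {M : ℝ}
    (hM : ∀ᵐ x ∂angleMeasure, |f x| ≤ M) (Z : Matrix (Fin n) (Fin n) ℂ) :
    frobSq (toep n f * Z) ≤ (2 * Real.pi * M) ^ 2 * frobSq Z := by
  rw [frobSq, frobSq, Finset.mul_sum]
  refine Finset.sum_le_sum fun j _ => ?_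
  have h : ∀ i, (toep n f * Z) i j =
      ∫ x, chr ((i : ℕ) : ℤ) x * (f x * trig (fun k => Z k j) x) ∂angleMeasure := fun i => by
    rw [← toep_mulVec (integrable_of_memLp_top hf)]; rfl
  simp_rw [h]
  refine (sum_norm_integral_sq_le hf hM (memLp_trig _)).trans (le_of_eq ?_)
  rw [integral_norm_trig_sq]; ring

/-- Column j of the difference consists of Fourier coefficients of f times the remainder of the
truncated Fourier series of φ = g e^(-ijx). Bessel bounds it by the mean-square remainder. Summed
over j, this is a Parseval defect, which is o(n). -/
lemma frobSq_toep_mul_toep_sub_le {n : ℕ} {f g : ℝ → ℝ} (hf : MemLp f ⊤ angleMeasure)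
    (hg : MemLp g ⊤ angleMeasure) {M : ℝ} (hM : ∀ᵐ x ∂angleMeasure, |f x| ≤ M) :
    frobSq (toep n f * toep n g - toep n (fun x => 2 * Real.pi * f x * g x)) ≤
      4 * Real.pi ^ 2 * M ^ 2 *
        (n * (2 * Real.pi * ∫ x, g x ^ 2 ∂angleMeasure) - frobSq (toep n g)) := by
  have hcol : ∀ j : Fin n, ∑ i, ‖(toep n f * toep n g -
      toep n (fun x => 2 * Real.pi * f x * g x)) i j‖ ^ 2 ≤
      4 * Real.pi ^ 2 * M ^ 2 * ((2 * Real.pi * ∫ x, g x ^ 2 ∂angleMeasure) -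
        ∑ i, ‖toep n g i j‖ ^ 2) := by
    intro j
    set w : Fin n → ℂ := fun i => toep n g i j with hw
    set φ : ℝ → ℂ := fun x => g x * chr (-((j : ℕ) : ℤ)) x with hφ
    have hφm : MemLp φ ⊤ angleMeasure := memLp_top_mul hg.ofReal (memLp_chr _)
    have hwφ : ∀ l, w l = ∫ x, chr ((l : ℕ) : ℤ) x * φ x ∂angleMeasure := fun l => by
      simp only [hw, toep, Matrix.of_apply, hφ]
      refine integral_congr_ae (Eventually.of_forall fun x => ?_)
      simp only [sub_eq_add_neg, chr_add]; ring
    have hres : MemLp (fun x => trig w x - 2 * Real.pi * φ x) ⊤ angleMeasure :=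
      (memLp_trig w).sub (hφm.const_mul _)
    have hE : ∀ i, (toep n f * toep n g - toep n (fun x => 2 * Real.pi * f x * g x)) i j =
        ∫ x, chr ((i : ℕ) : ℤ) x * (f x * (trig w x - 2 * Real.pi * φ x)) ∂angleMeasure := by
      intro i
      have h1 : (toep n f * toep n g) i j =
          ∫ x, chr ((i : ℕ) : ℤ) x * (f x * trig w x) ∂angleMeasure := by
        rw [← toep_mulVec (integrable_of_memLp_top hf)]; rfl
      rw [Matrix.sub_apply, h1]
      simp only [toep, Matrix.of_apply]
      rw [← integral_sub]
      · refine integral_congr_ae (Eventually.of_forall fun x => ?_)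
        simp only [hφ, sub_eq_add_neg, chr_add]
        push_cast; ring
      · exact integrable_chr_mul (integrable_mul_trig (integrable_of_memLp_top hf).ofReal _) _
      · refine integrable_chr_mul_ofReal ?_ _
        have := integrable_of_memLp_top (memLp_top_mul_real hf hg)
        refine (this.const_mul (2 * Real.pi)).congr (Eventually.of_forall fun x => ?_)
        simp only; ring
    simp_rw [hE]
    refine (sum_norm_integral_sq_le hf hM hres).trans (le_of_eq ?_)
    rw [integral_norm_trig_sub_sq hφm hwφ]
    have : ∀ x, ‖φ x‖ ^ 2 = g x ^ 2 := fun x => by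
      simp only [hφ, norm_mul, norm_chr, mul_one, Complex.norm_real, Real.norm_eq_abs, sq_abs]
    simp_rw [this]
    ring
  refine (Finset.sum_le_sum fun j _ => hcol j).trans (le_of_eq ?_)
  rw [← Finset.mul_sum, Finset.sum_sub_distrib, frobSq]
  simp

/-! ### Parseval's identity and the Frobenius norm of a Toeplitz matrix. -/

section Parseval

lemma hasSum_norm_sq_integral_chr {g : ℝ → ℝ} (hg : MemLp g ⊤ angleMeasure) :
    HasSum (fun m : ℤ => ‖∫ x, chr m x * (g x : ℂ) ∂angleMeasure‖ ^ 2)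
      (2 * Real.pi * ∫ x, g x ^ 2 ∂angleMeasure) := by
  have hpi := Real.pi_pos
  have hab : -Real.pi < Real.pi := by linarith
  have hres : (volume.restrict (Set.Ioc (-Real.pi) Real.pi)) = angleMeasure :=
    Measure.restrict_congr_set Ioc_ae_eq_Icc
  have hL2 : MemLp (fun x => (g x : ℂ)) 2 (volume.restrict (Set.Ioc (-Real.pi) Real.pi)) := by
    rw [hres]; exact hg.ofReal.mono_exponent le_top
  have h := hasSum_sq_fourierCoeffOn hab hL2
  -- `fourierCoeffOn` integrates against e^(-imx) and divides by 2π, hence the reflection m ↦ -m and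
  -- the factor (2π)².
  have hcoef : ∀ m : ℤ, ‖∫ x, chr m x * (g x : ℂ) ∂angleMeasure‖ ^ 2 =
      (2 * Real.pi) ^ 2 * ‖fourierCoeffOn hab (fun x => (g x : ℂ)) (-m)‖ ^ 2 := by
    intro m
    rw [fourierCoeffOn_eq_integral, norm_smul,
      mul_pow ‖1 / (Real.pi - -Real.pi)‖, ← mul_assoc]
    have h1 : (2 * Real.pi) ^ 2 * ‖1 / (Real.pi - -Real.pi)‖ ^ 2 = 1 := by
      rw [Real.norm_eq_abs, sq_abs]; field_simp; ring
    rw [h1, one_mul, intervalIntegral.integral_of_le hab.le, hres]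
    congr 2
    refine integral_congr_ae (Eventually.of_forall fun x => ?_)
    simp only [neg_neg, smul_eq_mul]
    congr 1
    rw [fourier_coe_apply, chr]
    congr 1
    push_cast
    have : (Real.pi : ℂ) ≠ 0 := by exact_mod_cast hpi.ne'
    field_simp
    ring
  simp_rw [hcoef]
  have h2 := (((Equiv.neg ℤ).hasSum_iff.2 h).mul_left ((2 * Real.pi) ^ 2))
  have e : (2 * Real.pi) ^ 2 * ((Real.pi - -Real.pi)⁻¹ •
      ∫ x in (-Real.pi)..Real.pi, ‖(g x : ℂ)‖ ^ 2) =
      2 * Real.pi * ∫ x, g x ^ 2 ∂angleMeasure := by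
    rw [intervalIntegral.integral_of_le hab.le, hres, smul_eq_mul, ← mul_assoc]
    simp only [Complex.norm_real, Real.norm_eq_abs, sq_abs]
    congr 1
    field_simp
    ring
  rw [← e]
  exact h2

/-- Enlarging the n × n square by one row and one column adds u n, the sum of a m over |m| ≤ n. The
normalized double sum is thus a Cesàro mean of symmetric partial sums. Subtracting a 0 in u corrects
the double count of m = 0. -/
lemma tendsto_sum_sum_sub_div {a : ℤ → ℝ} {s : ℝ} (h : HasSum a s) :
    Tendsto (fun n : ℕ => (∑ j : Fin n, ∑ i : Fin n, a (((i : ℕ) : ℤ) - ((j : ℕ) : ℤ))) / n)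
      atTop (𝓝 s) := by
  have h1 := (HasSum.nat_add_neg h).tendsto_sum_nat
  set u : ℕ → ℝ := fun n => ∑ k ∈ Finset.range (n + 1), (a k + a (-k)) - a 0 with hu
  have hu_lim : Tendsto u atTop (𝓝 s) := by
    have := ((tendsto_add_atTop_iff_nat 1).2 h1).sub_const (a 0)
    simpa using this
  have hsum : ∀ n : ℕ, ∑ j : Fin n, ∑ i : Fin n, a (((i : ℕ) : ℤ) - ((j : ℕ) : ℤ)) =
      ∑ k ∈ Finset.range n, u k := by
    intro n
    simp_rw [fun j : ℕ => Fin.sum_univ_eq_sum_range (fun i => a ((i : ℤ) - (j : ℤ))) n]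
    rw [Fin.sum_univ_eq_sum_range (fun j => ∑ i ∈ Finset.range n, a ((i : ℤ) - (j : ℤ))) n]
    induction n with
    | zero => simp
    | succ n ih =>
      rw [Finset.sum_range_succ, Finset.sum_range_succ _ n]
      simp_rw [Finset.sum_range_succ (fun i : ℕ => a ((i : ℤ) - _)) n]
      rw [Finset.sum_add_distrib, ih, Finset.sum_range_succ u n, hu]
      simp only
      rw [Finset.sum_range_succ', Finset.sum_add_distrib,
        ← Finset.sum_range_reflect (fun k : ℕ => a ((n : ℤ) - (k : ℤ))) n,
        ← Finset.sum_range_reflect (fun k : ℕ => a ((k : ℤ) - (n : ℤ))) n]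
      have e1 : ∑ k ∈ Finset.range n, a ((n : ℤ) - ((n - 1 - k : ℕ) : ℤ)) =
          ∑ k ∈ Finset.range n, a ((k + 1 : ℕ) : ℤ) := by
        refine Finset.sum_congr rfl fun k hk => ?_
        have := Finset.mem_range.1 hk
        congr 1; omega
      have e2 : ∑ k ∈ Finset.range n, a (((n - 1 - k : ℕ) : ℤ) - (n : ℤ)) =
          ∑ k ∈ Finset.range n, a (-((k + 1 : ℕ) : ℤ)) := by
        refine Finset.sum_congr rfl fun k hk => ?_
        have := Finset.mem_range.1 hk
        congr 1; omega
      rw [e1, e2]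
      simp
      ring
  simp_rw [hsum]
  refine hu_lim.cesaro.congr fun n => ?_
  rw [div_eq_inv_mul]

lemma tendsto_frobSq_toep_div {g : ℝ → ℝ} (hg : MemLp g ⊤ angleMeasure) :
    Tendsto (fun n : ℕ => frobSq (toep n g) / n) atTop
      (𝓝 (2 * Real.pi * ∫ x, g x ^ 2 ∂angleMeasure)) := by
  have h := tendsto_sum_sum_sub_div (hasSum_norm_sq_integral_chr hg)
  simpa only [frobSq, toep, Matrix.of_apply] using h

end Parseval

/-! ### The trace limit for bounded symbols. -/

/-- `Z_n` is asymptotic to `S_n(φ)` in the normalized Frobenius norm. -/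
def FrobAsymp (Z : (n : ℕ) → Matrix (Fin n) (Fin n) ℂ) (φ : ℝ → ℝ) : Prop :=
  Tendsto (fun n : ℕ => frobSq (Z n - toep n φ) / n) atTop (𝓝 0)

lemma exists_bound_of_memLp_top {f : ℝ → ℝ} (hf : MemLp f ⊤ angleMeasure) :
    ∃ M, ∀ᵐ x ∂angleMeasure, |f x| ≤ M := by
  refine ⟨(eLpNorm f ⊤ angleMeasure).toReal, ?_⟩
  filter_upwards [ae_le_eLpNormEssSup (f := f) (μ := angleMeasure)] with x hx
  rw [← eLpNorm_exponent_top] at hx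
  rw [← Real.norm_eq_abs, ← toReal_enorm]
  exact ENNReal.toReal_mono hf.eLpNorm_ne_top hx

/-- The error splits into the old error multiplied by a matrix of bounded operator norm and the
Parseval defect of φ. Both vanish after division by n. -/
lemma FrobAsymp.toep_mul {Z : (n : ℕ) → Matrix (Fin n) (Fin n) ℂ} {f φ : ℝ → ℝ}
    (h : FrobAsymp Z φ) (hf : MemLp f ⊤ angleMeasure) (hφ : MemLp φ ⊤ angleMeasure) :
    FrobAsymp (fun n => toep n f * Z n) (fun x => 2 * Real.pi * f x * φ x) := by
  obtain ⟨M, hM⟩ := exists_bound_of_memLp_top hf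
  have hlim : Tendsto (fun n : ℕ => 2 * ((2 * Real.pi * M) ^ 2 *
      (frobSq (Z n - toep n φ) / n)) + 2 * (4 * Real.pi ^ 2 * M ^ 2 *
        ((2 * Real.pi * ∫ x, φ x ^ 2 ∂angleMeasure) - frobSq (toep n φ) / n))) atTop (𝓝 0) := by
    have h1 := ((h.const_mul ((2 * Real.pi * M) ^ 2)).const_mul 2).add
      ((((tendsto_frobSq_toep_div hφ).const_sub
        (2 * Real.pi * ∫ x, φ x ^ 2 ∂angleMeasure)).const_mul (4 * Real.pi ^ 2 * M ^ 2)).const_mul 2)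
    simpa using h1
  refine squeeze_zero' (Eventually.of_forall fun n => div_nonneg (frobSq_nonneg _) (by positivity))
    ?_ hlim
  filter_upwards [eventually_gt_atTop 0] with n hn
  have hn' : (0 : ℝ) < n := by exact_mod_cast hn
  have hsplit : toep n f * Z n - toep n (fun x => 2 * Real.pi * f x * φ x) =
      toep n f * (Z n - toep n φ) +
        (toep n f * toep n φ - toep n (fun x => 2 * Real.pi * f x * φ x)) := by
    rw [mul_sub]; abel
  rw [hsplit, div_le_iff₀ hn']
  refine (frobSq_add_le _ _).trans ?_
  have h1 := frobSq_toep_mul_le hf hM (Z n - toep n φ)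
  have h2 := frobSq_toep_mul_toep_sub_le (n := n) hf hφ hM
  have e : (2 * ((2 * Real.pi * M) ^ 2 * (frobSq (Z n - toep n φ) / n)) +
      2 * (4 * Real.pi ^ 2 * M ^ 2 * (2 * Real.pi * ∫ x, φ x ^ 2 ∂angleMeasure -
        frobSq (toep n φ) / n))) * n = 2 * ((2 * Real.pi * M) ^ 2 * frobSq (Z n - toep n φ)) +
      2 * (4 * Real.pi ^ 2 * M ^ 2 * (n * (2 * Real.pi * ∫ x, φ x ^ 2 ∂angleMeasure) -
        frobSq (toep n φ))) := by
    field_simp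
  rw [e]
  linarith

/-- Cauchy–Schwarz on the diagonal gives |Tr M|² ≤ n ‖M‖², with the Frobenius norm on the right. -/
lemma FrobAsymp.tendsto_trace {Z : (n : ℕ) → Matrix (Fin n) (Fin n) ℂ} {φ : ℝ → ℝ}
    (h : FrobAsymp Z φ) :
    Tendsto (fun n : ℕ => (1 / (n : ℂ)) * (Z n).trace) atTop
      (𝓝 ((∫ x, φ x ∂angleMeasure : ℝ) : ℂ)) := by
  rw [tendsto_iff_norm_sub_tendsto_zero]
  have hs : Tendsto (fun n : ℕ => Real.sqrt (frobSq (Z n - toep n φ) / n)) atTop (𝓝 0) := by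
    simpa using h.sqrt
  refine squeeze_zero' (Eventually.of_forall fun n => norm_nonneg _) ?_ hs
  filter_upwards [eventually_gt_atTop 0] with n hn
  have hn' : (0 : ℝ) < n := by exact_mod_cast hn
  have hnC : (n : ℂ) ≠ 0 := by exact_mod_cast hn.ne'
  have e : (1 / (n : ℂ)) * (Z n).trace - ((∫ x, φ x ∂angleMeasure : ℝ) : ℂ) =
      (1 / (n : ℂ)) * (Z n - toep n φ).trace := by
    rw [Matrix.trace_sub, trace_toep]
    push_cast; field_simp
  rw [e]
  refine Real.le_sqrt_of_sq_le ?_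
  rw [norm_mul, mul_pow, norm_div, norm_one, Complex.norm_natCast]
  have := norm_trace_sq_le (Z n - toep n φ)
  calc (1 / (n : ℝ)) ^ 2 * ‖(Z n - toep n φ).trace‖ ^ 2
      ≤ (1 / (n : ℝ)) ^ 2 * (n * frobSq (Z n - toep n φ)) := by gcongr
    _ = _ := by field_simp

lemma frobAsymp_pow {f g : ℝ → ℝ} (hf : MemLp f ⊤ angleMeasure) (hg : MemLp g ⊤ angleMeasure)
    (q : ℕ) : MemLp (fun x => (2 * Real.pi) ^ (2 * q) * (f x * g x) ^ q * (2 * Real.pi)⁻¹) ⊤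
        angleMeasure ∧
      FrobAsymp (fun n => (toep n f * toep n g) ^ q)
        (fun x => (2 * Real.pi) ^ (2 * q) * (f x * g x) ^ q * (2 * Real.pi)⁻¹) := by
  have hpi := Real.pi_pos
  induction q with
  | zero =>
    simp only [mul_zero, pow_zero, one_mul]
    refine ⟨memLp_const _, ?_⟩
    refine tendsto_const_nhds.congr fun n => ?_
    -- The identity is the Toeplitz matrix of the constant 1/(2π), which explains the trailing
    -- factor in the symbol.
    rw [toep_const, mul_inv_cancel₀ (by positivity)]
    simp [frobSq]
  | succ q ih =>
    obtain ⟨h1, h2⟩ := ih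
    have h3 := h2.toep_mul hg h1
    have hm : MemLp (fun x => 2 * Real.pi * g x *
        ((2 * Real.pi) ^ (2 * q) * (f x * g x) ^ q * (2 * Real.pi)⁻¹)) ⊤ angleMeasure :=
      memLp_top_mul_real (hg.const_mul _) h1
    have h4 := h3.toep_mul hf hm
    have hm2 := memLp_top_mul_real (hf.const_mul (2 * Real.pi)) hm
    have e : (fun x => (2 * Real.pi) ^ (2 * (q + 1)) * (f x * g x) ^ (q + 1) * (2 * Real.pi)⁻¹) =
        fun x => 2 * Real.pi * f x * (2 * Real.pi * g x *
          ((2 * Real.pi) ^ (2 * q) * (f x * g x) ^ q * (2 * Real.pi)⁻¹)) := by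
      funext x; ring
    rw [e]
    refine ⟨hm2, ?_⟩
    simp_rw [pow_succ' (toep _ f * toep _ g) q, mul_assoc (toep _ f)]
    exact h4

/-- The limit of the normalized trace for bounded symbols. -/
lemma tendsto_trace_of_memLp_top {f g : ℝ → ℝ} (hf : MemLp f ⊤ angleMeasure)
    (hg : MemLp g ⊤ angleMeasure) {p : ℕ} (hp : 1 ≤ p) :
    Tendsto (fun n : ℕ => (1 / (n : ℂ)) * ((toep n f * toep n g) ^ p).trace) atTop
      (𝓝 (((2 * Real.pi) ^ (2 * p - 1) * ∫ x, (f x * g x) ^ p ∂angleMeasure : ℝ) : ℂ)) := by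
  have h := (frobAsymp_pow hf hg p).2.tendsto_trace
  convert h using 3
  rw [integral_mul_const, integral_const_mul]
  have : (2 * Real.pi) ^ (2 * p) = (2 * Real.pi) ^ (2 * p - 1) * (2 * Real.pi) := by
    rw [← pow_succ]; congr 1; omega
  rw [this]
  have hpi := Real.pi_pos
  field_simp

/-! ### Integrals of powers of |x|. -/

section PowerIntegrals

lemma intervalIntegrable_abs_rpow {s : ℝ} (hs : -1 < s) {r : ℝ} (hr : 0 ≤ r) :
    IntervalIntegrable (fun x : ℝ => |x| ^ s) volume 0 r :=
  (intervalIntegral.intervalIntegrable_rpow' hs).congr fun x hx => by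
    rw [Set.uIoc_of_le hr] at hx
    simp only [abs_of_pos hx.1]

lemma intervalIntegrable_abs_rpow_neg {s : ℝ} (hs : -1 < s) {r : ℝ} (hr : 0 ≤ r) :
    IntervalIntegrable (fun x : ℝ => |x| ^ s) volume (-r) 0 := by
  have := (IntervalIntegrable.iff_comp_neg (by simp)).1 (intervalIntegrable_abs_rpow hs hr)
  simp only [abs_neg, neg_zero] at this
  exact this.symm

lemma integrableOn_abs_rpow {s : ℝ} (hs : -1 < s) {r : ℝ} (hr : 0 ≤ r) :
    IntegrableOn (fun x : ℝ => |x| ^ s) (Set.Icc (-r) r) := by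
  rw [integrableOn_Icc_iff_integrableOn_Ioc,
    ← intervalIntegrable_iff_integrableOn_Ioc_of_le (by linarith)]
  exact (intervalIntegrable_abs_rpow_neg hs hr).trans (intervalIntegrable_abs_rpow hs hr)

lemma setIntegral_abs_rpow {s : ℝ} (hs : -1 < s) {r : ℝ} (hr : 0 ≤ r) :
    ∫ x in Set.Icc (-r) r, |x| ^ s = 2 * r ^ (s + 1) / (s + 1) := by
  rw [integral_Icc_eq_integral_Ioc, ← intervalIntegral.integral_of_le (by linarith),
    ← intervalIntegral.integral_add_adjacent_intervals (intervalIntegrable_abs_rpow_neg hs hr)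
      (intervalIntegrable_abs_rpow hs hr)]
  have h1 : ∫ x in (0 : ℝ)..r, |x| ^ s = r ^ (s + 1) / (s + 1) := by
    have : ∫ x in (0 : ℝ)..r, |x| ^ s = ∫ x in (0 : ℝ)..r, x ^ s := by
      refine intervalIntegral.integral_congr fun x hx => ?_
      rw [Set.uIcc_of_le hr] at hx
      simp only [abs_of_nonneg hx.1]
    rw [this, integral_rpow (Or.inl hs), Real.zero_rpow (by linarith), sub_zero]
  have h2 : ∫ x in (-r)..0, |x| ^ s = ∫ x in (0 : ℝ)..r, |x| ^ s := by
    have := intervalIntegral.integral_comp_neg (a := 0) (b := r) (fun x : ℝ => |x| ^ s)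
    simp only [abs_neg, neg_zero] at this
    exact this.symm
  rw [h2, h1]; ring

end PowerIntegrals

/-! ### Symbols dominated by a power. -/

/-- A nonnegative symbol on `[-π, π]` which is bounded by `C|x|^{-α}`. -/
structure IsSymbol (C α : ℝ) (f : ℝ → ℝ) : Prop where
  aestronglyMeasurable : AEStronglyMeasurable f angleMeasure
  bound : ∀ᵐ x ∂angleMeasure, 0 ≤ f x ∧ f x ≤ C * |x| ^ (-α)

namespace IsSymbol

variable {C α : ℝ} {f : ℝ → ℝ}

lemma nonneg (hf : IsSymbol C α f) : 0 ≤ᵐ[angleMeasure] f := by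
  filter_upwards [hf.bound] with x hx using hx.1

lemma integrable (hf : IsSymbol C α f) (hα : α < 1) : Integrable f angleMeasure := by
  have h := (integrableOn_abs_rpow (s := -α) (by linarith) Real.pi_pos.le).const_mul C
  refine Integrable.mono' h hf.aestronglyMeasurable ?_
  filter_upwards [hf.bound] with x hx
  rw [Real.norm_eq_abs, abs_of_nonneg hx.1]
  exact hx.2

lemma posSemidef (hf : IsSymbol C α f) (hα : α < 1) (n : ℕ) : (toep n f).PosSemidef :=
  posSemidef_toep (hf.integrable hα) hf.nonneg n

lemma indicator (hf : IsSymbol C α f) {s : Set ℝ} (hs : MeasurableSet s) :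
    IsSymbol C α (s.indicator f) := by
  refine ⟨hf.aestronglyMeasurable.indicator hs, ?_⟩
  filter_upwards [hf.bound] with x hx
  by_cases h : x ∈ s
  · rwa [Set.indicator_of_mem h]
  · rw [Set.indicator_of_notMem h]
    exact ⟨le_rfl, hx.1.trans hx.2⟩

end IsSymbol

/-! ### Dyadic decomposition around the origin. -/

section Levels

open scoped Classical in
/-- The dyadic level of `x`, truncated at `J`. -/
noncomputable def level (J : ℕ) (x : ℝ) : ℕ :=
  Nat.findGreatest (fun m => |x| ≤ Real.pi / 2 ^ m) J

lemma level_le (J : ℕ) (x : ℝ) : level J x ≤ J := Nat.findGreatest_le _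

lemma measurable_level (J : ℕ) : Measurable (level J) := by
  classical
  refine measurable_findGreatest fun k _ => ?_
  exact measurableSet_le measurable_norm measurable_const

lemma abs_le_of_level {J j : ℕ} {x : ℝ} (hx : |x| ≤ Real.pi) (h : level J x = j) :
    |x| ≤ Real.pi / 2 ^ j := by
  classical
  -- The default value 0 of `Nat.findGreatest` is harmless: for m = 0 the condition reads |x| ≤ π.
  have := Nat.findGreatest_spec (P := fun m => |x| ≤ Real.pi / 2 ^ m) (Nat.zero_le J)
    (by simpa using hx)
  rw [← h]
  unfold level
  convert this

lemma level_lt_iff {J m : ℕ} (hm : m ≤ J) {x : ℝ} (hx : |x| ≤ Real.pi) :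
    level J x < m ↔ Real.pi / 2 ^ m < |x| := by
  classical
  constructor
  · intro h
    have := Nat.findGreatest_is_greatest (P := fun m => |x| ≤ Real.pi / 2 ^ m) (n := J) (k := m)
      (by unfold level at h; convert h) hm
    simpa using this
  · intro h
    by_contra hcon
    push Not at hcon
    have h1 := abs_le_of_level hx (rfl : level J x = level J x)
    have h2 : Real.pi / 2 ^ (level J x) ≤ Real.pi / 2 ^ m := by
      gcongr
      norm_num
    linarith

/-- The restriction of `f` to the points of level `j`. -/
noncomputable def piece (J j : ℕ) (f : ℝ → ℝ) : ℝ → ℝ := {x | level J x = j}.indicator f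

lemma measurableSet_level (J j : ℕ) : MeasurableSet {x | level J x = j} :=
  measurable_level J (measurableSet_singleton j)

lemma IsSymbol.piece {C α : ℝ} {f : ℝ → ℝ} (hf : IsSymbol C α f) (J j : ℕ) :
    IsSymbol C α (piece J j f) := hf.indicator (measurableSet_level J j)

lemma ae_abs_le_pi : ∀ᵐ x ∂angleMeasure, |x| ≤ Real.pi := by
  filter_upwards [ae_restrict_mem measurableSet_Icc] with x hx
  exact abs_le.2 hx

lemma integral_piece_le {C α : ℝ} (hC : 0 ≤ C) (hα : α < 1) {f : ℝ → ℝ} (hf : IsSymbol C α f)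
    (J j : ℕ) : ∫ x, piece J j f x ∂angleMeasure ≤
      C * (2 * (Real.pi / 2 ^ j) ^ (1 - α) / (1 - α)) := by
  have hpi := Real.pi_pos
  set r := Real.pi / 2 ^ j with hr
  have hr0 : 0 ≤ r := by positivity
  have hrpi : r ≤ Real.pi := div_le_self hpi.le (one_le_pow₀ (by norm_num))
  have hs : (-1 : ℝ) < -α := by linarith
  have hint : Integrable ((Set.Icc (-r) r).indicator fun x => C * |x| ^ (-α)) angleMeasure := by
    refine Integrable.indicator ?_ measurableSet_Icc
    exact (integrableOn_abs_rpow hs hpi.le).const_mul C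
  calc ∫ x, piece J j f x ∂angleMeasure
      ≤ ∫ x, (Set.Icc (-r) r).indicator (fun x => C * |x| ^ (-α)) x ∂angleMeasure := by
        refine integral_mono_of_nonneg (hf.piece J j).nonneg hint ?_
        filter_upwards [hf.bound, ae_abs_le_pi] with x hx hxpi
        by_cases h : level J x = j
        · have h1 : x ∈ Set.Icc (-r) r := abs_le.1 (abs_le_of_level hxpi h)
          rw [Set.indicator_of_mem h1, Toeplitz.piece, Set.indicator_of_mem (by exact h)]
          exact hx.2
        · rw [Toeplitz.piece, Set.indicator_of_notMem (by exact h)]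
          exact Set.indicator_nonneg (fun y _ => by positivity) x
    _ = ∫ x in Set.Icc (-r) r, C * |x| ^ (-α) := by
        rw [integral_indicator measurableSet_Icc, Measure.restrict_restrict measurableSet_Icc]
        congr 2
        refine Set.inter_eq_left.2 (Set.Icc_subset_Icc ?_ hrpi)
        linarith
    _ = _ := by
        rw [integral_const_mul, setIntegral_abs_rpow hs hr0]
        congr 2
        · ring_nf
        · ring

lemma div_two_pow_rpow (j : ℕ) (s : ℝ) :
    (Real.pi / 2 ^ j) ^ s = Real.pi ^ s * (2 : ℝ) ^ (-(j : ℝ) * s) := by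
  rw [Real.div_rpow Real.pi_pos.le (by positivity), ← Real.rpow_natCast,
    ← Real.rpow_mul (by norm_num), neg_mul, Real.rpow_neg (by norm_num), div_eq_mul_inv]

lemma posSemidef_smul_one_sub_mono {n : ℕ} {A : Matrix (Fin n) (Fin n) ℂ} {a b : ℝ} (hab : a ≤ b)
    (h : ((a : ℂ) • (1 : Matrix (Fin n) (Fin n) ℂ) - A).PosSemidef) :
    ((b : ℂ) • (1 : Matrix (Fin n) (Fin n) ℂ) - A).PosSemidef := by
  have h1 : (((b - a : ℝ) : ℂ) • (1 : Matrix (Fin n) (Fin n) ℂ)).PosSemidef :=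
    Matrix.PosSemidef.one.smul (by exact_mod_cast sub_nonneg.2 hab)
  convert h1.add h using 1
  push_cast
  rw [sub_smul]; abel

/-- The masses and the operator norms of the dyadic pieces. -/
lemma exists_piece_bounds {C α : ℝ} (hC : 0 ≤ C) (hα : α < 1) :
    ∃ K : ℝ, 0 ≤ K ∧ ∀ f : ℝ → ℝ, IsSymbol C α f → ∀ J j : ℕ, j ≤ J →
      ∫ x, piece J j f x ∂angleMeasure ≤ K * (2 : ℝ) ^ (-(j : ℝ) * (1 - α)) ∧
      ∀ n : ℕ, (n : ℝ) ≤ 2 ^ (J + 1) →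
        (((K * (2 : ℝ) ^ ((j : ℝ) * α) : ℝ) : ℂ) • (1 : Matrix (Fin n) (Fin n) ℂ) -
          toep n (piece J j f)).PosSemidef := by
  have hpi := Real.pi_pos
  set K1 := C * (2 * Real.pi ^ (1 - α) / (1 - α)) with hK1
  set K2 := C * (2 : ℝ) ^ |α| * Real.pi ^ (-α) with hK2
  have h1α : 0 < 1 - α := by linarith
  have hK1n : 0 ≤ K1 := by positivity
  have hK2n : 0 ≤ K2 := by positivity
  refine ⟨2 * K1 + 2 * Real.pi * K2, by positivity, fun f hf J j hj => ?_⟩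
  have hmass : ∫ x, piece J j f x ∂angleMeasure ≤ K1 * (2 : ℝ) ^ (-(j : ℝ) * (1 - α)) := by
    refine (integral_piece_le hC hα hf J j).trans (le_of_eq ?_)
    rw [div_two_pow_rpow, hK1]; ring
  refine ⟨hmass.trans (mul_le_mul_of_nonneg_right ?_ (by positivity)), fun n hn => ?_⟩
  · nlinarith [mul_nonneg hpi.le hK2n]
  -- Below level J the piece lives on an annulus and has a pointwise bound. Level J contains a
  -- neighbourhood of 0, so n times the mass is used instead, and n ≤ 2^(J+1) turns it into the same
  -- power of 2.
  rcases hj.lt_or_eq with hlt | rfl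
  · have hle : ∀ᵐ x ∂angleMeasure, piece J j f x ≤ K2 * (2 : ℝ) ^ ((j : ℝ) * α) := by
      filter_upwards [hf.bound, ae_abs_le_pi] with x hx hxpi
      by_cases h : level J x = j
      · rw [Toeplitz.piece, Set.indicator_of_mem (by exact h)]
        have hup := abs_le_of_level hxpi h
        have hlow : Real.pi / 2 ^ (j + 1) < |x| := (level_lt_iff hlt hxpi).1 (by omega)
        set r := Real.pi / 2 ^ j with hr
        have hr0 : 0 < r := by positivity
        have hlow' : r / 2 < |x| := by
          rw [hr, div_div, ← pow_succ]; exact hlow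
        have hx0 : 0 < |x| := by linarith
        have hc1 : |x| / r ≤ 1 := (div_le_one hr0).2 hup
        have hc2 : 1 / 2 ≤ |x| / r := by
          rw [div_le_div_iff₀ (by norm_num) hr0]; linarith
        -- The ratio lies in [1/2, 1], and α may have either sign.
        have hratio : (|x| / r) ^ (-α) ≤ (2 : ℝ) ^ |α| := by
          calc (|x| / r) ^ (-α) ≤ (|x| / r) ^ (-|α|) :=
                Real.rpow_le_rpow_of_exponent_ge (by positivity) hc1
                  (neg_le_neg (le_abs_self α))
            _ ≤ (1 / 2 : ℝ) ^ (-|α|) :=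
                Real.rpow_le_rpow_of_nonpos (by norm_num) hc2 (by simp)
            _ = _ := by
                rw [one_div, Real.inv_rpow (by norm_num), Real.rpow_neg (by norm_num), inv_inv]
        have hrp : r ^ (-α) = Real.pi ^ (-α) * (2 : ℝ) ^ ((j : ℝ) * α) := by
          rw [hr, div_two_pow_rpow]; congr 2; ring
        calc f x ≤ C * |x| ^ (-α) := hx.2
          _ = C * ((|x| / r) ^ (-α) * r ^ (-α)) := by
              rw [← Real.mul_rpow (by positivity) hr0.le, div_mul_cancel₀ _ hr0.ne']
          _ ≤ C * ((2 : ℝ) ^ |α| * r ^ (-α)) := by gcongr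
          _ = _ := by rw [hrp, hK2]; ring
      · rw [Toeplitz.piece, Set.indicator_of_notMem (by exact h)]; positivity
    refine posSemidef_smul_one_sub_mono ?_
      (posSemidef_smul_one_sub_toep ((hf.piece J j).integrable hα) hle n)
    rw [← mul_assoc]
    exact mul_le_mul_of_nonneg_right (by linarith) (by positivity)
  · refine posSemidef_smul_one_sub_mono ?_
      (posSemidef_integral_smul_one_sub_toep ((hf.piece j j).integrable hα) (hf.piece j j).nonneg n)
    have h0 : 0 ≤ ∫ x, piece j j f x ∂angleMeasure := integral_nonneg_of_ae (hf.piece j j).nonneg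
    calc (n : ℝ) * ∫ x, piece j j f x ∂angleMeasure
        ≤ 2 ^ (j + 1) * (K1 * (2 : ℝ) ^ (-(j : ℝ) * (1 - α))) := by gcongr
      _ = 2 * K1 * (2 : ℝ) ^ ((j : ℝ) * α) := by
          have : (2 : ℝ) ^ ((j : ℝ) * α) = (2 : ℝ) ^ j * (2 : ℝ) ^ (-(j : ℝ) * (1 - α)) := by
            rw [← Real.rpow_natCast, ← Real.rpow_add (by norm_num)]; congr 1; ring
          rw [this]; ring
      _ ≤ _ := mul_le_mul_of_nonneg_right (by nlinarith [mul_nonneg hpi.le hK2n]) (by positivity)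

end Levels

/-! ### Estimates for pairs of dyadic pieces. -/

section Pairs

/-- `(Re Tr (S_n(f) S_n(g))^p)^(1/p)`. -/
noncomputable def psi (n p : ℕ) (f g : ℝ → ℝ) : ℝ := traceNorm p (toep n f) (toep n g)

lemma psi_comm {p : ℕ} (hp : 1 ≤ p) (n : ℕ) (f g : ℝ → ℝ) : psi n p f g = psi n p g f :=
  traceNorm_comm hp _ _

/-- The eigenvalues of YAY are at most ab and its trace is at most b·n·a·r. Here r acts as the width
of the support of f: mass divided by height. -/
lemma psi_near_le {C C' α β : ℝ} (hα : α < 1) (hβ : β < 1) {f g : ℝ → ℝ}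
    (hf : IsSymbol C α f) (hg : IsSymbol C' β g) {n p : ℕ} (hp : 1 ≤ p) {a b r : ℝ}
    (ha0 : 0 ≤ a) (hb0 : 0 ≤ b)
    (ha : ((a : ℂ) • (1 : Matrix (Fin n) (Fin n) ℂ) - toep n f).PosSemidef)
    (hb : ((b : ℂ) • (1 : Matrix (Fin n) (Fin n) ℂ) - toep n g).PosSemidef)
    (hm : ∫ x, f x ∂angleMeasure ≤ a * r) (hr : 0 ≤ r) :
    psi n p f g ≤ a * b * (n * r) ^ (1 / (p : ℝ)) := by
  have hA := hf.posSemidef hα n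
  have hB := hg.posSemidef hβ n
  refine (traceNorm_le_of_le hA hB ha0 hb0 ha hb hp).trans ?_
  have htr : (toep n f).trace.re ≤ n * (a * r) := by
    rw [trace_toep, Complex.ofReal_re]; gcongr
  have htr0 : 0 ≤ (toep n f).trace.re := by simpa using trace_pow_re_nonneg hA 1
  have hp0 : p ≠ 0 := by omega
  calc ((a * b) ^ (p - 1) * (b * (toep n f).trace.re)) ^ (1 / (p : ℝ))
      ≤ ((a * b) ^ (p - 1) * (b * (n * (a * r)))) ^ (1 / (p : ℝ)) := by gcongr
    _ = ((a * b) ^ p * (n * r)) ^ (1 / (p : ℝ)) := by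
        congr 1
        obtain ⟨q, rfl⟩ := Nat.exists_eq_add_of_le' hp
        rw [Nat.add_sub_cancel, pow_succ]; ring
    _ = _ := by
        rw [Real.mul_rpow (by positivity) (by positivity), one_div,
          Real.pow_rpow_inv_natCast (by positivity) hp0]

/-- The estimate for a pair of dyadic pieces. -/
lemma exists_psi_piece_le {C α β : ℝ} (hC : 0 ≤ C) (hα : α < 1) (hβ : β < 1) :
    ∃ K : ℝ, 0 ≤ K ∧ ∀ f g : ℝ → ℝ, IsSymbol C α f → IsSymbol C β g → ∀ n p J j k : ℕ, 1 ≤ p →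
      (2 : ℝ) ^ J ≤ n → (n : ℝ) ≤ 2 ^ (J + 1) → j ≤ k → k ≤ J →
      psi n p (piece J j f) (piece J k g) ≤ K * (n : ℝ) ^ (1 / (p : ℝ)) *
        (2 : ℝ) ^ ((j : ℝ) * (α + β - 1 / p) - min (1 - α) (1 - β) * ((k : ℝ) - j)) := by
  obtain ⟨K1, hK1, h1⟩ := exists_piece_bounds hC hα
  obtain ⟨K2, hK2, h2⟩ := exists_piece_bounds hC hβ
  have hpi := Real.pi_pos
  set δ := min (1 - α) (1 - β) with hδ
  have hδ0 : 0 < δ := lt_min (by linarith) (by linarith)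
  have hδβ : δ ≤ 1 - β := min_le_right _ _
  -- The first summand serves k ≤ j + 1, where 2^(|β|+δ) pays for replacing k by j. The second
  -- serves k ≥ j + 2, where 16 comes from |D_n| ≤ 4·2^j.
  refine ⟨K1 * K2 * (2 : ℝ) ^ (|β| + δ) + 16 * K1 * K2, by positivity, ?_⟩
  intro f g hf hg n p J j k hp hn1 hn2 hjk hkJ
  obtain ⟨hm1, ho1⟩ := h1 f hf J j (hjk.trans hkJ)
  obtain ⟨hm2, ho2⟩ := h2 g hg J k hkJ
  have hfj := hf.piece J j
  have hgk := hg.piece J k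
  have hp0 : (0 : ℝ) < p := by exact_mod_cast hp
  set X := (2 : ℝ) ^ ((j : ℝ) * (α + β - 1 / p) - δ * ((k : ℝ) - j)) with hX
  have hX0 : 0 ≤ X := by positivity
  have hjk' : (j : ℝ) ≤ k := by exact_mod_cast hjk
  suffices h : psi n p (piece J j f) (piece J k g) ≤
        K1 * K2 * (2 : ℝ) ^ (|β| + δ) * (n : ℝ) ^ (1 / (p : ℝ)) * X ∨
      psi n p (piece J j f) (piece J k g) ≤ 16 * K1 * K2 * (n : ℝ) ^ (1 / (p : ℝ)) * X by
    rw [add_mul, add_mul]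
    rcases h with h | h
    · exact h.trans (le_add_of_nonneg_right (by positivity))
    · exact h.trans (le_add_of_nonneg_left (by positivity))
  -- Two levels of separation are what guarantees |y| ≤ |x|/2, hence the off-peak bound on the
  -- Dirichlet kernel.
  by_cases hnear : k ≤ j + 1
  · left
    have hk1 : (k : ℝ) - j ≤ 1 := by
      have : (k : ℝ) ≤ j + 1 := by exact_mod_cast hnear
      linarith
    have hmass : ∫ x, piece J j f x ∂angleMeasure ≤
        K1 * (2 : ℝ) ^ ((j : ℝ) * α) * (2 : ℝ) ^ (-(j : ℝ)) := by
      rw [mul_assoc, ← Real.rpow_add (by norm_num)]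
      convert hm1 using 3; ring
    refine (psi_near_le hα hβ hfj hgk hp (by positivity) (by positivity) (ho1 n hn2) (ho2 n hn2)
      hmass (by positivity)).trans ?_
    rw [Real.mul_rpow (by positivity) (by positivity), ← Real.rpow_mul (by norm_num)]
    have e : K1 * (2 : ℝ) ^ ((j : ℝ) * α) * (K2 * (2 : ℝ) ^ ((k : ℝ) * β)) *
        ((n : ℝ) ^ (1 / (p : ℝ)) * (2 : ℝ) ^ (-(j : ℝ) * (1 / p))) =
        K1 * K2 * (n : ℝ) ^ (1 / (p : ℝ)) *
          (2 : ℝ) ^ ((j : ℝ) * α + (k : ℝ) * β + -(j : ℝ) * (1 / p)) := by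
      rw [Real.rpow_add (by norm_num), Real.rpow_add (by norm_num)]; ring
    have e2 : K1 * K2 * (2 : ℝ) ^ (|β| + δ) * (n : ℝ) ^ (1 / (p : ℝ)) * X =
        K1 * K2 * (n : ℝ) ^ (1 / (p : ℝ)) *
          (2 : ℝ) ^ (|β| + δ + ((j : ℝ) * (α + β - 1 / p) - δ * ((k : ℝ) - j))) := by
      rw [Real.rpow_add (by norm_num) (|β| + δ)]; ring
    rw [e, e2]
    refine mul_le_mul_of_nonneg_left ?_ (by positivity)
    refine Real.rpow_le_rpow_of_exponent_le (by norm_num) ?_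
    have hb1 : ((k : ℝ) - j) * β ≤ |β| := by
      calc ((k : ℝ) - j) * β ≤ ((k : ℝ) - j) * |β| :=
            mul_le_mul_of_nonneg_left (le_abs_self β) (by linarith)
        _ ≤ 1 * |β| := mul_le_mul_of_nonneg_right hk1 (abs_nonneg β)
        _ = _ := one_mul _
    have hb2 : δ * ((k : ℝ) - j) ≤ δ := by nlinarith
    nlinarith
  · right
    push Not at hnear
    have hjJ : j < J := by omega
    have hdir : ∀ᵐ x ∂angleMeasure, piece J j f x ≠ 0 → ∀ᵐ y ∂angleMeasure, piece J k g y ≠ 0 →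
        ‖dirichlet n (x - y)‖ ^ 2 ≤ 16 * (2 : ℝ) ^ (2 * (j : ℝ)) := by
      filter_upwards [ae_abs_le_pi] with x hxpi hxf
      filter_upwards [ae_abs_le_pi] with y hypi hyg
      have hlx : level J x = j := by
        by_contra h; exact hxf (Set.indicator_of_notMem (by exact h) _)
      have hly : level J y = k := by
        by_contra h; exact hyg (Set.indicator_of_notMem (by exact h) _)
      have hlow : Real.pi / 2 ^ (j + 1) < |x| := (level_lt_iff hjJ hxpi).1 (by omega)
      have hup := abs_le_of_level hypi hly
      have hup2 : Real.pi / 2 ^ k ≤ Real.pi / 2 ^ (j + 1) / 2 := by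
        rw [div_div, ← pow_succ]
        gcongr
        · norm_num
        · omega
      have hx0 : 0 < |x| := lt_trans (by positivity) hlow
      have hD := norm_dirichlet_le_of_far n hxpi (abs_pos.1 hx0) (by linarith : |y| ≤ |x| / 2)
      have hD2 : ‖dirichlet n (x - y)‖ ≤ 4 * 2 ^ j := by
        refine hD.trans ?_
        rw [div_le_iff₀ hx0]
        have : 4 * 2 ^ j * (Real.pi / 2 ^ (j + 1)) ≤ 4 * 2 ^ j * |x| := by gcongr
        refine le_trans (le_of_eq ?_) this
        rw [pow_succ]; field_simp; norm_num
      calc ‖dirichlet n (x - y)‖ ^ 2 ≤ (4 * 2 ^ j) ^ 2 := pow_le_pow_left₀ (norm_nonneg _) hD2 2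
        _ = _ := by
          rw [mul_comm 2 (j : ℝ), Real.rpow_mul (by norm_num), Real.rpow_natCast]
          norm_cast
          ring
    have htr := trace_toep_mul_toep_le (hfj.integrable hα) (hgk.integrable hβ) hfj.nonneg hgk.nonneg
      hdir
    refine (traceNorm_le_trace_re (hfj.posSemidef hα n) (hgk.posSemidef hβ n) hp).trans
      (htr.trans ?_)
    have hg0 : 0 ≤ ∫ x, piece J k g x ∂angleMeasure := integral_nonneg_of_ae hgk.nonneg
    -- The kernel estimate gives 2^(j(α+β) - (1-β)(k-j)) with no power of n. Since 2^j ≤ n, the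
    -- factor 2^(j/p) can be traded for n^(1/p) to match the adjacent case.
    have hn2j : (2 : ℝ) ^ ((j : ℝ) * (1 / p)) ≤ (n : ℝ) ^ (1 / (p : ℝ)) := by
      rw [Real.rpow_mul (by norm_num), Real.rpow_natCast]
      refine Real.rpow_le_rpow (by positivity) (le_trans ?_ hn1) (by positivity)
      exact pow_le_pow_right₀ (by norm_num) hjJ.le
    calc 16 * (2 : ℝ) ^ (2 * (j : ℝ)) * (∫ x, piece J j f x ∂angleMeasure) *
          ∫ y, piece J k g y ∂angleMeasure
        ≤ 16 * (2 : ℝ) ^ (2 * (j : ℝ)) * (K1 * (2 : ℝ) ^ (-(j : ℝ) * (1 - α))) *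
          (K2 * (2 : ℝ) ^ (-(k : ℝ) * (1 - β))) := by gcongr
      _ = 16 * K1 * K2 * (2 : ℝ) ^ (2 * (j : ℝ) + -(j : ℝ) * (1 - α) + -(k : ℝ) * (1 - β)) := by
          rw [Real.rpow_add (by norm_num), Real.rpow_add (by norm_num)]; ring
      _ ≤ 16 * K1 * K2 * ((2 : ℝ) ^ ((j : ℝ) * (1 / p)) * X) := by
          refine mul_le_mul_of_nonneg_left ?_ (by positivity)
          rw [hX, ← Real.rpow_add (by norm_num)]
          refine Real.rpow_le_rpow_of_exponent_le (by norm_num) ?_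
          have : δ * ((k : ℝ) - j) ≤ (1 - β) * ((k : ℝ) - j) :=
            mul_le_mul_of_nonneg_right hδβ (by linarith)
          nlinarith
      _ ≤ 16 * K1 * K2 * ((n : ℝ) ^ (1 / (p : ℝ)) * X) := by gcongr
      _ = _ := by ring

end Pairs

/-! ### Monotonicity, subadditivity and stability in the symbols. -/

section Subadditivity

lemma traceNorm_sum_left_le {ι κ : Type*} [Fintype ι] [DecidableEq ι] (s : Finset κ)
    {A : κ → Matrix ι ι ℂ} {B : Matrix ι ι ℂ} (hA : ∀ k ∈ s, (A k).PosSemidef)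
    (hB : B.PosSemidef) {p : ℕ} (hp : 1 ≤ p) :
    traceNorm p (∑ k ∈ s, A k) B ≤ ∑ k ∈ s, traceNorm p (A k) B := by
  classical
  induction s using Finset.induction_on with
  | empty =>
    have hp0 : p ≠ 0 := by omega
    simp [traceNorm, hp0]
  | insert a s ha ih =>
    rw [Finset.sum_insert ha, Finset.sum_insert ha]
    have hs : (∑ k ∈ s, A k).PosSemidef :=
      Matrix.posSemidef_sum s fun k hk => hA k (Finset.mem_insert_of_mem hk)
    refine (traceNorm_add_left_le (hA a (Finset.mem_insert_self _ _)) hs hB hp).trans ?_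
    gcongr
    exact ih fun k hk => hA k (Finset.mem_insert_of_mem hk)

lemma psi_congr {f f' g g' : ℝ → ℝ} (hf : f =ᵐ[angleMeasure] f') (hg : g =ᵐ[angleMeasure] g')
    (n p : ℕ) : psi n p f g = psi n p f' g' := by
  rw [psi, psi, toep_congr_ae hf, toep_congr_ae hg]

lemma psi_add_left_le {f f' g : ℝ → ℝ} (hf : Integrable f angleMeasure)
    (hf' : Integrable f' angleMeasure) (hg : Integrable g angleMeasure)
    (hf0 : 0 ≤ᵐ[angleMeasure] f) (hf0' : 0 ≤ᵐ[angleMeasure] f') (hg0 : 0 ≤ᵐ[angleMeasure] g)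
    {p : ℕ} (hp : 1 ≤ p) (n : ℕ) :
    psi n p (fun x => f x + f' x) g ≤ psi n p f g + psi n p f' g := by
  rw [psi, toep_add hf hf']
  exact traceNorm_add_left_le (posSemidef_toep hf hf0 n) (posSemidef_toep hf' hf0' n)
    (posSemidef_toep hg hg0 n) hp

lemma psi_mono_left {f f' g : ℝ → ℝ} (hf : Integrable f angleMeasure)
    (hf' : Integrable f' angleMeasure) (hg : Integrable g angleMeasure)
    (hf0 : 0 ≤ᵐ[angleMeasure] f) (hle : f ≤ᵐ[angleMeasure] f') (hg0 : 0 ≤ᵐ[angleMeasure] g)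
    {p : ℕ} (hp : 1 ≤ p) (n : ℕ) : psi n p f g ≤ psi n p f' g := by
  have hsub : 0 ≤ᵐ[angleMeasure] fun x => f' x - f x := by
    filter_upwards [hle] with x hx
    simpa using hx
  have e : toep n f' = toep n f + toep n (fun x => f' x - f x) := by
    rw [toep_sub hf' hf]; abel
  rw [psi, psi, e]
  exact traceNorm_le_add_left (posSemidef_toep hf hf0 n)
    (posSemidef_toep (hf'.sub hf) hsub n) (posSemidef_toep hg hg0 n) hp

lemma psi_mono {f f' g g' : ℝ → ℝ} (hf : Integrable f angleMeasure)
    (hf' : Integrable f' angleMeasure) (hg : Integrable g angleMeasure)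
    (hg' : Integrable g' angleMeasure)
    (hf0 : 0 ≤ᵐ[angleMeasure] f) (hf0' : 0 ≤ᵐ[angleMeasure] f') (hg0 : 0 ≤ᵐ[angleMeasure] g)
    (hle : f ≤ᵐ[angleMeasure] f') (hle' : g ≤ᵐ[angleMeasure] g')
    {p : ℕ} (hp : 1 ≤ p) (n : ℕ) : psi n p f g ≤ psi n p f' g' := by
  refine (psi_mono_left hf hf' hg hf0 hle hg0 hp n).trans ?_
  rw [psi_comm hp n f' g, psi_comm hp n f' g']
  exact psi_mono_left hg hg' hf' hg0 hle' hf0' hp n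

lemma psi_le_of_bdd {f g : ℝ → ℝ} (hf : Integrable f angleMeasure)
    (hg : Integrable g angleMeasure) (hf0 : 0 ≤ᵐ[angleMeasure] f) (hg0 : 0 ≤ᵐ[angleMeasure] g)
    {A B : ℝ} (hA : ∀ᵐ x ∂angleMeasure, f x ≤ A) (hB : ∀ᵐ x ∂angleMeasure, g x ≤ B)
    (hA0 : 0 ≤ A) (hB0 : 0 ≤ B) {p : ℕ} (hp : 1 ≤ p) (n : ℕ) :
    psi n p f g ≤ 4 * Real.pi ^ 2 * A * B * (n : ℝ) ^ (1 / (p : ℝ)) := by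
  have hpi := Real.pi_pos
  have hsf : IsSymbol A 0 f := ⟨hf.aestronglyMeasurable, by
    filter_upwards [hf0, hA] with x h1 h2
    exact ⟨h1, by simpa using h2⟩⟩
  have hsg : IsSymbol B 0 g := ⟨hg.aestronglyMeasurable, by
    filter_upwards [hg0, hB] with x h1 h2
    exact ⟨h1, by simpa using h2⟩⟩
  have hm : ∫ x, f x ∂angleMeasure ≤ 2 * Real.pi * A * 1 := by
    calc ∫ x, f x ∂angleMeasure ≤ ∫ _, A ∂angleMeasure :=
          integral_mono_ae hf (integrable_const A) hA
      _ = A * ∫ _, (1 : ℝ) ∂angleMeasure := by rw [← integral_const_mul]; simp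
      _ = _ := by rw [angleMeasure_integral_one]; ring
  have := psi_near_le (by norm_num) (by norm_num) hsf hsg (n := n) hp (by positivity)
    (by positivity) (posSemidef_smul_one_sub_toep hf hA n) (posSemidef_smul_one_sub_toep hg hB n)
    hm zero_le_one
  rw [mul_one] at this
  refine this.trans (le_of_eq (by ring))

/-- Stability of `psi` under uniformly small perturbations of bounded symbols. -/
lemma psi_le_add_of_close {f f' g g' : ℝ → ℝ} (hf : Integrable f angleMeasure)
    (hf' : Integrable f' angleMeasure) (hg : Integrable g angleMeasure)
    (hg' : Integrable g' angleMeasure)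
    (hf0 : 0 ≤ᵐ[angleMeasure] f) (hf0' : 0 ≤ᵐ[angleMeasure] f') (hg0 : 0 ≤ᵐ[angleMeasure] g)
    (hg0' : 0 ≤ᵐ[angleMeasure] g') {M δ : ℝ} (hM0 : 0 ≤ M) (hδ0 : 0 ≤ δ)
    (hM : ∀ᵐ x ∂angleMeasure, f' x ≤ M) (hM' : ∀ᵐ x ∂angleMeasure, g' x ≤ M)
    (hδ : ∀ᵐ x ∂angleMeasure, f x ≤ f' x + δ) (hδ' : ∀ᵐ x ∂angleMeasure, g x ≤ g' x + δ)
    {p : ℕ} (hp : 1 ≤ p) (n : ℕ) :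
    psi n p f g ≤ psi n p f' g' + 4 * Real.pi ^ 2 * δ * (2 * M + δ) * (n : ℝ) ^ (1 / (p : ℝ)) := by
  have hc : Integrable (fun _ : ℝ => δ) angleMeasure := integrable_const δ
  have hc0 : 0 ≤ᵐ[angleMeasure] fun _ : ℝ => δ := Eventually.of_forall fun _ => hδ0
  have hfd0 : 0 ≤ᵐ[angleMeasure] fun x => f' x + δ := by
    filter_upwards [hf0'] with x hx using add_nonneg hx hδ0
  have hgd0 : 0 ≤ᵐ[angleMeasure] fun x => g' x + δ := by
    filter_upwards [hg0'] with x hx using add_nonneg hx hδ0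
  -- Raise f, g to f' + δ, g' + δ and expand by subadditivity. The pairs (f', δ) and (δ, g' + δ)
  -- cost δM and δ(M + δ), up to the factor 4π² n^(1/p).
  have h1 := psi_mono hf (hf'.add hc) hg (hg'.add hc) hf0 hfd0 hg0 hδ hδ' hp n
  have h2 := psi_add_left_le hf' hc (hg'.add hc) hf0' hc0 hgd0 hp n
  have h3 := psi_add_left_le hg' hc hf' hg0' hc0 hf0' hp n
  have h4 := psi_le_of_bdd hc hf' hc0 hf0' (Eventually.of_forall fun _ => le_rfl) hM hδ0 hM0 hp n
  have h5 := psi_le_of_bdd hc (hg'.add hc) hc0 hgd0 (Eventually.of_forall fun _ => le_rfl)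
    (B := M + δ) (by filter_upwards [hM'] with x hx using by simpa using hx) hδ0 (by linarith) hp n
  rw [psi_comm hp n g' f', psi_comm hp n _ f'] at h3
  simp only [Pi.add_def] at h1 h2 h3 h5
  calc psi n p f g ≤ _ := h1
    _ ≤ _ := h2
    _ ≤ _ := add_le_add h3 h5
    _ ≤ _ := by linarith

end Subadditivity

/-! ### Summation over levels: tail bound and growth bound. -/

section Splitting

/-- The restriction of `f` to the points with `π/2^m < |x|`. -/
noncomputable def low (m : ℕ) (f : ℝ → ℝ) : ℝ → ℝ := {x | Real.pi / 2 ^ m < |x|}.indicator f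

/-- The restriction of `f` to the points with `|x| ≤ π/2^m`. -/
noncomputable def high (m : ℕ) (f : ℝ → ℝ) : ℝ → ℝ := {x | Real.pi / 2 ^ m < |x|}ᶜ.indicator f

lemma measurableSet_low (m : ℕ) : MeasurableSet {x : ℝ | Real.pi / 2 ^ m < |x|} :=
  measurableSet_lt measurable_const measurable_norm

lemma low_add_high (m : ℕ) (f : ℝ → ℝ) (x : ℝ) : low m f x + high m f x = f x :=
  congrFun (Set.indicator_self_add_compl _ f) x

variable {C α β : ℝ} {f g : ℝ → ℝ}

lemma IsSymbol.low (hf : IsSymbol C α f) (m : ℕ) : IsSymbol C α (low m f) :=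
  hf.indicator (measurableSet_low m)

lemma IsSymbol.high (hf : IsSymbol C α f) (m : ℕ) : IsSymbol C α (high m f) :=
  hf.indicator (measurableSet_low m).compl

lemma low_le (hf : IsSymbol C α f) (m : ℕ) : low m f ≤ᵐ[angleMeasure] f := by
  filter_upwards [hf.nonneg] with x hx
  exact Set.indicator_le_self' (fun _ _ => hx) x

lemma sum_piece_apply (s : Finset ℕ) (J : ℕ) (f : ℝ → ℝ) (x : ℝ) :
    ∑ j ∈ s, piece J j f x = if level J x ∈ s then f x else 0 := by
  classical
  simp only [Toeplitz.piece, Set.indicator_apply, Set.mem_ofPred_eq]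
  rw [Finset.sum_ite_eq]

lemma eq_sum_piece (J : ℕ) (f : ℝ → ℝ) :
    f = fun x => ∑ j ∈ Finset.range (J + 1), piece J j f x := by
  funext x
  rw [sum_piece_apply, if_pos (Finset.mem_range.2 (Nat.lt_succ_of_le (level_le J x)))]

lemma low_eq_sum_piece {J m : ℕ} (hm : m ≤ J) (f : ℝ → ℝ) :
    low m f =ᵐ[angleMeasure] fun x => ∑ j ∈ Finset.range m, piece J j f x := by
  filter_upwards [ae_abs_le_pi] with x hx
  classical
  simp only [sum_piece_apply, low, Set.indicator_apply, Set.mem_ofPred_eq, Finset.mem_range,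
    level_lt_iff hm hx]

lemma high_eq_sum_piece {J m : ℕ} (hm : m ≤ J) (f : ℝ → ℝ) :
    high m f =ᵐ[angleMeasure] fun x => ∑ j ∈ Finset.Ico m (J + 1), piece J j f x := by
  filter_upwards [low_eq_sum_piece hm f] with x hx
  have h1 := low_add_high m f x
  have h2 : f x = ∑ j ∈ Finset.range (J + 1), piece J j f x := congrFun (eq_sum_piece J f) x
  rw [← Finset.sum_range_add_sum_Ico _ (by omega : m ≤ J + 1)] at h2
  linarith

lemma psi_sum_piece_le (hα : α < 1) (hβ : β < 1) (hf : IsSymbol C α f) (hg : IsSymbol C β g)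
    {p : ℕ} (hp : 1 ≤ p) (n J : ℕ) (s t : Finset ℕ) :
    psi n p (fun x => ∑ j ∈ s, piece J j f x) (fun x => ∑ k ∈ t, piece J k g x) ≤
      ∑ j ∈ s, ∑ k ∈ t, psi n p (piece J j f) (piece J k g) := by
  have hfi : ∀ j, (toep n (piece J j f)).PosSemidef := fun j => (hf.piece J j).posSemidef hα n
  have hgi : ∀ j, (toep n (piece J j g)).PosSemidef := fun j => (hg.piece J j).posSemidef hβ n
  rw [psi, toep_finset_sum s fun j _ => (hf.piece J j).integrable hα,
    toep_finset_sum t fun j _ => (hg.piece J j).integrable hβ]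
  refine (traceNorm_sum_left_le s (fun k _ => hfi k)
    (Matrix.posSemidef_sum t fun k _ => hgi k) hp).trans ?_
  refine Finset.sum_le_sum fun j _ => ?_
  rw [traceNorm_comm hp]
  refine (traceNorm_sum_left_le t (fun k _ => hgi k) (hfi j) hp).trans (le_of_eq ?_)
  exact Finset.sum_congr rfl fun k _ => traceNorm_comm hp _ _

lemma exists_psi_piece_le_symm (hC : 0 ≤ C) (hα : α < 1) (hβ : β < 1) :
    ∃ K : ℝ, 0 ≤ K ∧ ∀ f g : ℝ → ℝ, IsSymbol C α f → IsSymbol C β g → ∀ n p J j k : ℕ, 1 ≤ p →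
      (2 : ℝ) ^ J ≤ n → (n : ℝ) ≤ 2 ^ (J + 1) → j ≤ J → k ≤ J →
      psi n p (piece J j f) (piece J k g) ≤ K * (n : ℝ) ^ (1 / (p : ℝ)) *
        (2 : ℝ) ^ (((min j k : ℕ) : ℝ) * (α + β - 1 / p) -
          min (1 - α) (1 - β) * (((max j k : ℕ) : ℝ) - (min j k : ℕ))) := by
  obtain ⟨K1, hK1, h1⟩ := exists_psi_piece_le hC hα hβ
  obtain ⟨K2, hK2, h2⟩ := exists_psi_piece_le hC hβ hα
  refine ⟨K1 + K2, by positivity, fun f g hf hg n p J j k hp hn1 hn2 hj hk => ?_⟩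
  rcases le_total j k with h | h
  · rw [min_eq_left h, max_eq_right h]
    refine (h1 f g hf hg n p J j k hp hn1 hn2 h hk).trans ?_
    gcongr
    linarith
  · rw [min_eq_right h, max_eq_left h, psi_comm hp]
    refine (h2 g f hg hf n p J k j hp hn1 hn2 h hj).trans ?_
    rw [add_comm β α, min_comm (1 - β)]
    gcongr
    linarith

lemma two_pow_log_le {n : ℕ} (hn : 1 ≤ n) :
    (2 : ℝ) ^ Nat.log 2 n ≤ n ∧ (n : ℝ) ≤ 2 ^ (Nat.log 2 n + 1) := by
  constructor
  · exact_mod_cast Nat.pow_log_le_self 2 (by omega)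
  · exact_mod_cast (Nat.lt_pow_succ_log_self (by norm_num) n).le

/-- The tail estimate in the integrable case. -/
lemma exists_psi_tail_le (hC : 0 ≤ C) (hα : α < 1) (hβ : β < 1) {p : ℕ} (hp : 1 ≤ p)
    (hs : (p : ℝ) * (α + β) < 1) :
    ∃ K θ : ℝ, 0 ≤ K ∧ 0 ≤ θ ∧ θ < 1 ∧ ∀ f g : ℝ → ℝ, IsSymbol C α f → IsSymbol C β g →
      ∀ n m : ℕ, (2 : ℕ) ^ m ≤ n →
        psi n p f g ≤ psi n p (low m f) (low m g) + K * θ ^ m * (n : ℝ) ^ (1 / (p : ℝ)) := by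
  obtain ⟨K, hK, hpair⟩ := exists_psi_piece_le_symm (C := C) hC hα hβ
  have hp0 : (0 : ℝ) < p := by exact_mod_cast hp
  have hs' : α + β - 1 / p < 0 := by
    rw [sub_neg, lt_div_iff₀ hp0]; linarith
  set δ := min (1 - α) (1 - β) with hδ
  have hδ0 : 0 < δ := lt_min (by linarith) (by linarith)
  -- With this η both decay rates are at least 2η, so the exponent is at most -2η max(j,k) ≤ -η(j+k)
  -- and the double sum factors into geometric series.
  set η := min (1 / p - (α + β)) δ / 2 with hη
  have hη0 : 0 < η := half_pos (lt_min (by linarith) hδ0)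
  set θ := (2 : ℝ) ^ (-η) with hθ
  have hθ0 : 0 < θ := by positivity
  have hθ1 : θ < 1 := Real.rpow_lt_one_of_one_lt_of_neg (by norm_num) (by linarith)
  have hterm : ∀ j k : ℕ, (2 : ℝ) ^ (((min j k : ℕ) : ℝ) * (α + β - 1 / p) -
      δ * (((max j k : ℕ) : ℝ) - (min j k : ℕ))) ≤ θ ^ j * θ ^ k := by
    intro j k
    rw [← pow_add, hθ, ← Real.rpow_natCast, ← Real.rpow_mul (by norm_num)]
    refine Real.rpow_le_rpow_of_exponent_le (by norm_num) ?_
    have h1 : 2 * η ≤ 1 / p - (α + β) := by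
      rw [hη]; linarith [min_le_left (1 / p - (α + β)) δ]
    have h2 : 2 * η ≤ δ := by
      rw [hη]; linarith [min_le_right (1 / p - (α + β)) δ]
    have hmm : ((min j k : ℕ) : ℝ) ≤ ((max j k : ℕ) : ℝ) := by
      exact_mod_cast min_le_max
    have hsum : ((j + k : ℕ) : ℝ) ≤ 2 * ((max j k : ℕ) : ℝ) := by
      exact_mod_cast (by omega : j + k ≤ 2 * max j k)
    have hmin : (0 : ℝ) ≤ ((min j k : ℕ) : ℝ) := by positivity
    have a1 : ((min j k : ℕ) : ℝ) * (2 * η) ≤ ((min j k : ℕ) : ℝ) * (1 / p - (α + β)) :=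
      mul_le_mul_of_nonneg_left h1 hmin
    have a2 : 2 * η * (((max j k : ℕ) : ℝ) - (min j k : ℕ)) ≤
        δ * (((max j k : ℕ) : ℝ) - (min j k : ℕ)) :=
      mul_le_mul_of_nonneg_right h2 (by linarith)
    have a3 : η * ((j + k : ℕ) : ℝ) ≤ η * (2 * ((max j k : ℕ) : ℝ)) :=
      mul_le_mul_of_nonneg_left hsum hη0.le
    nlinarith
  have hgeo : ∀ N : ℕ, ∑ j ∈ Finset.range N, θ ^ j ≤ (1 - θ)⁻¹ := fun N => by
    rw [← tsum_geometric_of_lt_one hθ0.le hθ1]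
    exact (summable_geometric_of_lt_one hθ0.le hθ1).sum_le_tsum _ fun _ _ => by positivity
  have hgeo' : ∀ m N : ℕ, ∑ j ∈ Finset.Ico m N, θ ^ j ≤ θ ^ m * (1 - θ)⁻¹ := fun m N => by
    rw [Finset.sum_Ico_eq_sum_range]
    simp_rw [pow_add]
    rw [← Finset.mul_sum]
    exact mul_le_mul_of_nonneg_left (hgeo _) (by positivity)
  have hθi : 0 < (1 - θ)⁻¹ := inv_pos.2 (by linarith)
  refine ⟨2 * K * (1 - θ)⁻¹ ^ 2, θ, by positivity, hθ0.le, hθ1, fun f g hf hg n m hm => ?_⟩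
  have hn : 1 ≤ n := le_trans Nat.one_le_two_pow hm
  set J := Nat.log 2 n with hJ
  obtain ⟨hn1, hn2⟩ := two_pow_log_le hn
  have hmJ : m ≤ J := Nat.le_log_of_pow_le (by norm_num) hm
  have hblock : ∀ s t : Finset ℕ, s ⊆ Finset.range (J + 1) → t ⊆ Finset.range (J + 1) →
      psi n p (fun x => ∑ j ∈ s, piece J j f x) (fun x => ∑ k ∈ t, piece J k g x) ≤
        K * (n : ℝ) ^ (1 / (p : ℝ)) * ((∑ j ∈ s, θ ^ j) * ∑ k ∈ t, θ ^ k) := by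
    intro s t hs ht
    refine (psi_sum_piece_le hα hβ hf hg hp n J s t).trans ?_
    rw [Finset.sum_mul_sum, Finset.mul_sum]
    refine Finset.sum_le_sum fun j hj => ?_
    rw [Finset.mul_sum]
    refine Finset.sum_le_sum fun k hk => ?_
    have hjJ := Finset.mem_range.1 (hs hj)
    have hkJ := Finset.mem_range.1 (ht hk)
    refine (hpair f g hf hg n p J j k hp hn1 hn2 (by omega) (by omega)).trans ?_
    exact mul_le_mul_of_nonneg_left (hterm j k) (by positivity)
  have hIco : Finset.Ico m (J + 1) ⊆ Finset.range (J + 1) := fun x hx =>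
    Finset.mem_range.2 (Finset.mem_Ico.1 hx).2
  have hrm : Finset.range m ⊆ Finset.range (J + 1) := Finset.range_subset_range.2 (by omega)
  have b1 : psi n p (high m f) g ≤
      K * (n : ℝ) ^ (1 / (p : ℝ)) * (θ ^ m * (1 - θ)⁻¹ * (1 - θ)⁻¹) := by
    rw [psi_congr (high_eq_sum_piece hmJ f) (Eventually.of_forall (congrFun (eq_sum_piece J g)))]
    refine (hblock _ _ hIco subset_rfl).trans ?_
    gcongr
    · exact hgeo' _ _
    · exact hgeo _
  have b2 : psi n p (low m f) (high m g) ≤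
      K * (n : ℝ) ^ (1 / (p : ℝ)) * ((1 - θ)⁻¹ * (θ ^ m * (1 - θ)⁻¹)) := by
    rw [psi_congr (low_eq_sum_piece hmJ f) (high_eq_sum_piece hmJ g)]
    refine (hblock _ _ hrm hIco).trans ?_
    gcongr
    · exact hgeo _
    · exact hgeo' _ _
  -- Split f first, then g against the low part of f. The error pairs are (high, all) and (low,
  -- high), each with a tail factor θ^m.
  have c1 := psi_add_left_le ((hf.low m).integrable hα) ((hf.high m).integrable hα)
    (hg.integrable hβ) (hf.low m).nonneg (hf.high m).nonneg hg.nonneg hp n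
  have c2 := psi_add_left_le ((hg.low m).integrable hβ) ((hg.high m).integrable hβ)
    ((hf.low m).integrable hα) (hg.low m).nonneg (hg.high m).nonneg (hf.low m).nonneg hp n
  simp only [low_add_high] at c1 c2
  rw [psi_comm hp n g, psi_comm hp n (low m g), psi_comm hp n (high m g)] at c2
  calc psi n p f g ≤ _ := c1
    _ ≤ _ := add_le_add c2 b1
    _ ≤ _ := by linarith [b2]

/-- The growth estimate in the non-integrable case. -/
lemma exists_psi_le_log (hC : 0 ≤ C) (hα : α < 1) (hβ : β < 1) {p : ℕ} (hp : 1 ≤ p)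
    (hs : 1 ≤ (p : ℝ) * (α + β)) :
    ∃ K : ℝ, 0 ≤ K ∧ ∀ f g : ℝ → ℝ, IsSymbol C α f → IsSymbol C β g → ∀ n : ℕ, 1 ≤ n →
      psi n p f g ≤ K * ((Nat.log 2 n + 1 : ℕ) : ℝ) ^ 2 * (n : ℝ) ^ (α + β) := by
  obtain ⟨K, hK, hpair⟩ := exists_psi_piece_le_symm (C := C) hC hα hβ
  have hp0 : (0 : ℝ) < p := by exact_mod_cast hp
  have hs' : 0 ≤ α + β - 1 / p := by
    rw [sub_nonneg, div_le_iff₀ hp0]; linarith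
  have hδ0 : 0 ≤ min (1 - α) (1 - β) := le_min (by linarith) (by linarith)
  refine ⟨K, hK, fun f g hf hg n hn => ?_⟩
  set J := Nat.log 2 n with hJ
  obtain ⟨hn1, hn2⟩ := two_pow_log_le hn
  have hn0 : (0 : ℝ) < n := by exact_mod_cast hn
  -- As α + β - 1/p ≥ 0, the worst case is min(j,k) = J, where 2^J ≤ n gives n^(α+β-1/p).
  have hterm : ∀ j ∈ Finset.range (J + 1), ∀ k ∈ Finset.range (J + 1),
      psi n p (piece J j f) (piece J k g) ≤ K * (n : ℝ) ^ (α + β) := by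
    intro j hj k hk
    have hj' := Finset.mem_range.1 hj
    have hk' := Finset.mem_range.1 hk
    refine (hpair f g hf hg n p J j k hp hn1 hn2 (by omega) (by omega)).trans ?_
    have hmm : ((min j k : ℕ) : ℝ) ≤ ((max j k : ℕ) : ℝ) := by exact_mod_cast min_le_max
    have hmJ : ((min j k : ℕ) : ℝ) ≤ J := by exact_mod_cast (by omega : min j k ≤ J)
    have h1 : (2 : ℝ) ^ (((min j k : ℕ) : ℝ) * (α + β - 1 / p) -
        min (1 - α) (1 - β) * (((max j k : ℕ) : ℝ) - (min j k : ℕ))) ≤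
        (n : ℝ) ^ (α + β - 1 / p) := by
      calc _ ≤ (2 : ℝ) ^ ((J : ℝ) * (α + β - 1 / p)) := by
            refine Real.rpow_le_rpow_of_exponent_le (by norm_num) ?_
            have a1 := mul_le_mul_of_nonneg_right hmJ hs'
            have a2 := mul_nonneg hδ0 (sub_nonneg.2 hmm)
            linarith
        _ ≤ _ := by
            rw [Real.rpow_mul (by norm_num), Real.rpow_natCast]
            exact Real.rpow_le_rpow (by positivity) hn1 hs'
    calc _ ≤ K * (n : ℝ) ^ (1 / (p : ℝ)) * (n : ℝ) ^ (α + β - 1 / p) :=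
          mul_le_mul_of_nonneg_left h1 (by positivity)
      _ = _ := by
          rw [mul_assoc, ← Real.rpow_add hn0]; congr 2; ring
  rw [psi_congr (Eventually.of_forall (congrFun (eq_sum_piece J f)))
    (Eventually.of_forall (congrFun (eq_sum_piece J g)))]
  refine (psi_sum_piece_le hα hβ hf hg hp n J _ _).trans ?_
  refine (Finset.sum_le_sum fun j hj => Finset.sum_le_sum fun k hk => hterm j hj k hk).trans
    (le_of_eq ?_)
  simp only [Finset.sum_const, Finset.card_range, nsmul_eq_mul]
  ring

end Splitting

/-! ### The limit and growth theorems for nonnegative symbols. -/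

section Limit

variable {C α β : ℝ} {F G : ℝ → ℝ}

lemma ae_ne_zero : ∀ᵐ x ∂angleMeasure, x ≠ (0 : ℝ) :=
  ae_restrict_of_ae (Measure.ae_ne volume 0)

/-- On π/2^m < |x| ≤ π the power |x|^(-α) is at most its value at one endpoint; the sum of both
covers either sign of α. The bound must be uniform in f, to hold for the whole sequence and its
limit. -/
lemma exists_low_le (α : ℝ) (C : ℝ) (m : ℕ) : ∃ M : ℝ, ∀ f, IsSymbol C α f →
    ∀ᵐ x ∂angleMeasure, low m f x ≤ |M| := by
  have hpi := Real.pi_pos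
  refine ⟨C * ((Real.pi / 2 ^ m) ^ (-α) + Real.pi ^ (-α)), fun f hf => ?_⟩
  filter_upwards [hf.bound, ae_abs_le_pi] with x hx hxpi
  by_cases h : x ∈ {x : ℝ | Real.pi / 2 ^ m < |x|}
  · rw [low, Set.indicator_of_mem h]
    have h' : Real.pi / 2 ^ m < |x| := h
    have hr : 0 < Real.pi / 2 ^ m := by positivity
    have hx0 : 0 < |x| := hr.trans h'
    have hC : 0 ≤ C := by
      have : 0 < |x| ^ (-α) := Real.rpow_pos_of_pos hx0 _
      nlinarith [hx.1.trans hx.2]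
    have hle : |x| ^ (-α) ≤ (Real.pi / 2 ^ m) ^ (-α) + Real.pi ^ (-α) := by
      rcases le_total 0 (-α) with hα | hα
      · exact (Real.rpow_le_rpow hx0.le hxpi hα).trans (le_add_of_nonneg_left (by positivity))
      · exact (Real.rpow_le_rpow_of_nonpos hr h'.le hα).trans
          (le_add_of_nonneg_right (by positivity))
    exact (hx.2.trans (mul_le_mul_of_nonneg_left hle hC)).trans (le_abs_self _)
  · rw [low, Set.indicator_of_notMem h]; exact abs_nonneg _

lemma memLp_low {f : ℝ → ℝ} (hf : IsSymbol C α f) (m : ℕ) :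
    MemLp (low m f) ⊤ angleMeasure := by
  obtain ⟨M, hM⟩ := exists_low_le α C m
  refine memLp_top_of_bound (hf.low m).aestronglyMeasurable |M| ?_
  filter_upwards [hM f hf, (hf.low m).nonneg] with x h1 h2
  rw [Real.norm_eq_abs, abs_of_nonneg h2]; exact h1

lemma integrable_mul_pow {p : ℕ} (hs : (p : ℝ) * (α + β) < 1)
    (hF : IsSymbol C α F) (hG : IsSymbol C β G) :
    Integrable (fun x => (F x * G x) ^ p) angleMeasure := by
  have h := (integrableOn_abs_rpow (s := -((p : ℝ) * (α + β))) (by linarith)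
    Real.pi_pos.le).const_mul ((C * C) ^ p)
  refine Integrable.mono' h ((hF.aestronglyMeasurable.mul hG.aestronglyMeasurable).pow p) ?_
  filter_upwards [hF.bound, hG.bound, ae_ne_zero] with x h1 h2 h0
  have hx0 : 0 < |x| := abs_pos.2 h0
  rw [Real.norm_eq_abs, abs_of_nonneg (pow_nonneg (mul_nonneg h1.1 h2.1) p)]
  calc (F x * G x) ^ p ≤ (C * |x| ^ (-α) * (C * |x| ^ (-β))) ^ p :=
        pow_le_pow_left₀ (mul_nonneg h1.1 h2.1)
          (mul_le_mul h1.2 h2.2 h2.1 (h1.1.trans h1.2)) p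
    _ = (C * C * |x| ^ (-(α + β))) ^ p := by
        congr 1
        rw [neg_add, Real.rpow_add hx0]; ring
    _ = _ := by
        rw [mul_pow, ← Real.rpow_natCast (|x| ^ (-(α + β))), ← Real.rpow_mul hx0.le]
        congr 2; ring

lemma tendsto_integral_low_mul_pow {p : ℕ} (hs : (p : ℝ) * (α + β) < 1)
    (hF : IsSymbol C α F) (hG : IsSymbol C β G) :
    Tendsto (fun m => ∫ x, (low m F x * low m G x) ^ p ∂angleMeasure) atTop
      (𝓝 (∫ x, (F x * G x) ^ p ∂angleMeasure)) := by
  refine tendsto_integral_of_dominated_convergence (fun x => (F x * G x) ^ p)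
    (fun m => ((hF.low m).aestronglyMeasurable.mul (hG.low m).aestronglyMeasurable).pow p)
    (integrable_mul_pow hs hF hG) (fun m => ?_) ?_
  · filter_upwards [(hF.low m).nonneg, (hG.low m).nonneg, low_le hF m, low_le hG m] with x a b c d
    rw [Real.norm_eq_abs, abs_of_nonneg (pow_nonneg (mul_nonneg a b) p)]
    exact pow_le_pow_left₀ (mul_nonneg a b) (mul_le_mul c d b (a.trans c)) p
  · filter_upwards [ae_ne_zero] with x hx
    refine tendsto_const_nhds.congr' ?_
    have h1 : Tendsto (fun m : ℕ => Real.pi / 2 ^ m) atTop (𝓝 0) := by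
      have := (tendsto_pow_atTop_nhds_zero_of_lt_one (r := (1 / 2 : ℝ)) (by norm_num)
        (by norm_num)).const_mul Real.pi
      simpa [div_eq_mul_inv] using this
    filter_upwards [h1.eventually_lt_const (abs_pos.2 hx)] with m hm
    have hmem : x ∈ {x : ℝ | Real.pi / 2 ^ m < |x|} := hm
    rw [low, low, Set.indicator_of_mem hmem, Set.indicator_of_mem hmem]

lemma psi_div_eq {n p : ℕ} (hp : 1 ≤ p) {f g : ℝ → ℝ} (hα : α < 1) (hβ : β < 1)
    (hf : IsSymbol C α f) (hg : IsSymbol C β g) :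
    psi n p f g / (n : ℝ) ^ (1 / (p : ℝ)) =
      (((toep n f * toep n g) ^ p).trace.re / n) ^ (1 / (p : ℝ)) := by
  rw [Real.div_rpow (trace_mul_pow_re_nonneg (hf.posSemidef hα n) (hg.posSemidef hβ n) hp)
    (by positivity)]
  rfl

lemma tendsto_psi_low {p : ℕ} (hp : 1 ≤ p) (hα : α < 1) (hβ : β < 1)
    (hF : IsSymbol C α F) (hG : IsSymbol C β G) (m : ℕ) :
    Tendsto (fun n : ℕ => psi n p (low m F) (low m G) / (n : ℝ) ^ (1 / (p : ℝ))) atTop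
      (𝓝 (((2 * Real.pi) ^ (2 * p - 1) *
        ∫ x, (low m F x * low m G x) ^ p ∂angleMeasure) ^ (1 / (p : ℝ)))) := by
  have h := tendsto_trace_of_memLp_top (memLp_low hF m) (memLp_low hG m) hp
  have h2 := (Complex.continuous_re.tendsto _).comp h
  rw [Complex.ofReal_re] at h2
  have h3 := h2.rpow_const (p := 1 / (p : ℝ)) (Or.inr (by positivity))
  refine h3.congr fun n => ?_
  rw [psi_div_eq hp hα hβ (hF.low m) (hG.low m)]
  simp only [Function.comp]
  congr 1
  have : (1 / (n : ℂ)) = ((1 / (n : ℝ) : ℝ) : ℂ) := by push_cast; rfl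
  rw [this, Complex.re_ofReal_mul]
  ring

/-- Uniform convergence almost everywhere. -/
def UnifConv (f : ℕ → ℝ → ℝ) (F : ℝ → ℝ) : Prop :=
  ∀ δ : ℝ, 0 < δ → ∀ᶠ n in atTop, ∀ᵐ x ∂angleMeasure, |f n x - F x| ≤ δ

lemma low_le_low_add {f g : ℝ → ℝ} {δ : ℝ} (hδ : 0 ≤ δ)
    (h : ∀ᵐ x ∂angleMeasure, |f x - g x| ≤ δ) (m : ℕ) :
    (∀ᵐ x ∂angleMeasure, low m f x ≤ low m g x + δ) ∧
      ∀ᵐ x ∂angleMeasure, low m g x ≤ low m f x + δ := by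
  constructor <;>
  · filter_upwards [h] with x hx
    have := abs_le.1 hx
    by_cases hm : x ∈ {x : ℝ | Real.pi / 2 ^ m < |x|}
    · rw [low, low, Set.indicator_of_mem hm, Set.indicator_of_mem hm]; linarith
    · rw [low, low, Set.indicator_of_notMem hm, Set.indicator_of_notMem hm]; linarith

/-- The convergence of the normalized trace for nonnegative symbols, in terms of `psi`. -/
lemma tendsto_psi {p : ℕ} (hp : 1 ≤ p) (hC : 0 ≤ C) (hα : α < 1) (hβ : β < 1)
    (hs : (p : ℝ) * (α + β) < 1) {f g : ℕ → ℝ → ℝ}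
    (hf : ∀ n, 1 ≤ n → IsSymbol C α (f n)) (hg : ∀ n, 1 ≤ n → IsSymbol C β (g n))
    (hF : IsSymbol C α F) (hG : IsSymbol C β G) (hfF : UnifConv f F) (hgG : UnifConv g G) :
    Tendsto (fun n : ℕ => psi n p (f n) (g n) / (n : ℝ) ^ (1 / (p : ℝ))) atTop
      (𝓝 (((2 * Real.pi) ^ (2 * p - 1) *
        ∫ x, (F x * G x) ^ p ∂angleMeasure) ^ (1 / (p : ℝ)))) := by
  have hpi := Real.pi_pos
  obtain ⟨K, θ, hK, hθ0, hθ1, htail⟩ := exists_psi_tail_le hC hα hβ hp hs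
  set Λ : ℕ → ℝ := fun m => ((2 * Real.pi) ^ (2 * p - 1) *
    ∫ x, (low m F x * low m G x) ^ p ∂angleMeasure) ^ (1 / (p : ℝ)) with hΛ
  have hΛlim : Tendsto Λ atTop (𝓝 (((2 * Real.pi) ^ (2 * p - 1) *
      ∫ x, (F x * G x) ^ p ∂angleMeasure) ^ (1 / (p : ℝ)))) :=
    ((tendsto_integral_low_mul_pow hs hF hG).const_mul _).rpow_const (Or.inr (by positivity))
  set Λ' := ((2 * Real.pi) ^ (2 * p - 1) *
      ∫ x, (F x * G x) ^ p ∂angleMeasure) ^ (1 / (p : ℝ)) with hΛ'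
  rw [Metric.tendsto_atTop']
  intro ε hε
  have hθlim : Tendsto (fun m : ℕ => K * θ ^ m) atTop (𝓝 0) := by
    simpa using (tendsto_pow_atTop_nhds_zero_of_lt_one hθ0 hθ1).const_mul K
  -- Order of choices: m makes the tail and the truncated limit accurate, then δ is small relative
  -- to the bound M attached to m, then n is large.
  obtain ⟨m, hm1, hm2⟩ := ((hθlim.eventually_lt_const (by linarith : (0 : ℝ) < ε / 4)).and
    ((Metric.tendsto_nhds.1 hΛlim) (ε / 4) (by linarith))).exists
  rw [Real.dist_eq] at hm2
  obtain ⟨M1, hM1⟩ := exists_low_le α C m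
  obtain ⟨M2, hM2⟩ := exists_low_le β C m
  set M := |M1| + |M2| with hM
  have hM0 : 0 ≤ M := by positivity
  obtain ⟨δ, hδ0, hδ⟩ : ∃ δ : ℝ, 0 < δ ∧ 4 * Real.pi ^ 2 * δ * (2 * M + δ) < ε / 4 := by
    have hc : Tendsto (fun δ : ℝ => 4 * Real.pi ^ 2 * δ * (2 * M + δ)) (𝓝[>] 0) (𝓝 0) := by
      have : Continuous fun δ : ℝ => 4 * Real.pi ^ 2 * δ * (2 * M + δ) := by fun_prop
      have h0 := this.tendsto 0
      simp only [mul_zero, zero_mul] at h0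
      exact h0.mono_left nhdsWithin_le_nhds
    obtain ⟨δ, h1, h2⟩ := ((hc.eventually_lt_const (by linarith : (0 : ℝ) < ε / 4)).and
      self_mem_nhdsWithin).exists
    exact ⟨δ, h2, h1⟩
  have hQ := (Metric.tendsto_nhds.1 (tendsto_psi_low hp hα hβ hF hG m)) (ε / 4) (by linarith)
  have hev := (((hfF δ hδ0).and (hgG δ hδ0)).and
    (hQ.and (eventually_ge_atTop (2 ^ m))))
  obtain ⟨N, hN⟩ := eventually_atTop.1 hev
  refine ⟨N, fun n hn => ?_⟩
  obtain ⟨⟨e1, e2⟩, e3, e4⟩ := hN n hn.le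
  rw [Real.dist_eq] at e3 ⊢
  have hn1 : 1 ≤ n := le_trans Nat.one_le_two_pow e4
  have hfn := hf n hn1
  have hgn := hg n hn1
  have hnp : 0 < (n : ℝ) ^ (1 / (p : ℝ)) := Real.rpow_pos_of_pos (by exact_mod_cast hn1) _
  obtain ⟨a1, a2⟩ := low_le_low_add hδ0.le e1 m
  obtain ⟨b1, b2⟩ := low_le_low_add hδ0.le e2 m
  have i1 := (hfn.low m).integrable hα
  have i2 := (hgn.low m).integrable hβ
  have i3 := (hF.low m).integrable hα
  have i4 := (hG.low m).integrable hβ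
  have hMα : ∀ f, IsSymbol C α f → ∀ᵐ x ∂angleMeasure, low m f x ≤ M := fun f hf => by
    filter_upwards [hM1 f hf] with x hx
    exact hx.trans (le_add_of_nonneg_right (abs_nonneg _))
  have hMβ : ∀ f, IsSymbol C β f → ∀ᵐ x ∂angleMeasure, low m f x ≤ M := fun f hf => by
    filter_upwards [hM2 f hf] with x hx
    exact hx.trans (le_add_of_nonneg_left (abs_nonneg _))
  have u1 := psi_le_add_of_close i1 i3 i2 i4 (hfn.low m).nonneg (hF.low m).nonneg
    (hgn.low m).nonneg (hG.low m).nonneg hM0 hδ0.le (hMα F hF) (hMβ G hG) a1 b1 hp n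
  have u2 := psi_le_add_of_close i3 i1 i4 i2 (hF.low m).nonneg (hfn.low m).nonneg
    (hG.low m).nonneg (hgn.low m).nonneg hM0 hδ0.le (hMα _ hfn) (hMβ _ hgn) a2 b2 hp n
  have u3 := htail (f n) (g n) hfn hgn n m e4
  have u4 := psi_mono i1 (hfn.integrable hα) i2 (hgn.integrable hβ) (hfn.low m).nonneg hfn.nonneg
    (hgn.low m).nonneg (low_le hfn m) (low_le hgn m) hp n
  set D := 4 * Real.pi ^ 2 * δ * (2 * M + δ) with hD
  -- The upper bound uses the tail estimate and stability. The lower bound needs only monotonicity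
  -- under truncation and stability.
  have up : psi n p (f n) (g n) / (n : ℝ) ^ (1 / (p : ℝ)) ≤
      psi n p (low m F) (low m G) / (n : ℝ) ^ (1 / (p : ℝ)) + D + K * θ ^ m := by
    rw [div_le_iff₀ hnp, add_mul, add_mul, div_mul_cancel₀ _ hnp.ne']
    linarith
  have lo : psi n p (low m F) (low m G) / (n : ℝ) ^ (1 / (p : ℝ)) ≤
      psi n p (f n) (g n) / (n : ℝ) ^ (1 / (p : ℝ)) + D := by
    rw [div_le_iff₀ hnp, add_mul, div_mul_cancel₀ _ hnp.ne']
    linarith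
  have q1 := abs_lt.1 e3
  have q2 := abs_lt.1 hm2
  rw [abs_lt]
  constructor <;> linarith [q1.1, q1.2, q2.1, q2.2]

/-- The convergence of the normalized trace for nonnegative symbols. -/
lemma tendsto_trace_of_isSymbol {p : ℕ} (hp : 1 ≤ p) (hC : 0 ≤ C) (hα : α < 1) (hβ : β < 1)
    (hs : (p : ℝ) * (α + β) < 1) {f g : ℕ → ℝ → ℝ}
    (hf : ∀ n, 1 ≤ n → IsSymbol C α (f n)) (hg : ∀ n, 1 ≤ n → IsSymbol C β (g n))
    (hF : IsSymbol C α F) (hG : IsSymbol C β G) (hfF : UnifConv f F) (hgG : UnifConv g G) :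
    Tendsto (fun n : ℕ => (1 / (n : ℂ)) * ((toep n (f n) * toep n (g n)) ^ p).trace) atTop
      (𝓝 (((2 * Real.pi) ^ (2 * p - 1) * ∫ x, (F x * G x) ^ p ∂angleMeasure : ℝ) : ℂ)) := by
  have hp0 : p ≠ 0 := by omega
  have h := (tendsto_psi hp hC hα hβ hs hf hg hF hG hfF hgG).pow p
  have hL : 0 ≤ (2 * Real.pi) ^ (2 * p - 1) * ∫ x, (F x * G x) ^ p ∂angleMeasure := by
    refine mul_nonneg (by positivity [Real.pi_pos]) (integral_nonneg_of_ae ?_)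
    filter_upwards [hF.nonneg, hG.nonneg] with x a b
    exact pow_nonneg (mul_nonneg a b) p
  rw [one_div, Real.rpow_inv_natCast_pow hL hp0] at h
  refine ((Complex.continuous_ofReal.tendsto _).comp h).congr' ?_
  filter_upwards [eventually_ge_atTop 1] with n hn
  have hA := (hf n hn).posSemidef hα n
  have hB := (hg n hn).posSemidef hβ n
  simp only [Function.comp]
  rw [div_pow, psi, traceNorm_pow hA hB hp, Real.rpow_inv_natCast_pow (by positivity) hp0]
  conv_rhs => rw [trace_mul_pow_eq_re hA hB hp]
  push_cast
  ring

/-- The growth of the trace for nonnegative symbols. -/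
lemma isLittleO_trace_of_isSymbol {p : ℕ} (hp : 1 ≤ p) (hC : 0 ≤ C) (hα : α < 1) (hβ : β < 1)
    (hs : 1 ≤ (p : ℝ) * (α + β)) {f g : ℕ → ℝ → ℝ}
    (hf : ∀ n, 1 ≤ n → IsSymbol C α (f n)) (hg : ∀ n, 1 ≤ n → IsSymbol C β (g n))
    {ψ : ℝ} (hψ : 0 < ψ) :
    (fun n : ℕ => ((toep n (f n) * toep n (g n)) ^ p).trace) =o[atTop]
      fun n : ℕ => (n : ℝ) ^ ((p : ℝ) * (α + β) + ψ) := by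
  obtain ⟨K, hK, h⟩ := exists_psi_le_log hC hα hβ hp hs
  have hlog : (fun n : ℕ => Real.log n ^ ((2 * p : ℕ) : ℝ)) =o[atTop] fun n : ℕ => (n : ℝ) ^ ψ :=
    (isLittleO_log_rpow_rpow_atTop _ hψ).comp_tendsto tendsto_natCast_atTop_atTop
  have hlog2 := (hlog.mul_isBigO (isBigO_refl (fun n : ℕ => (n : ℝ) ^ ((p : ℝ) * (α + β))) atTop))
  refine (IsBigO.trans_isLittleO (g := fun n : ℕ => Real.log n ^ ((2 * p : ℕ) : ℝ) *
    (n : ℝ) ^ ((p : ℝ) * (α + β))) ?_ hlog2).congr' EventuallyEq.rfl ?_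
  · refine IsBigO.of_bound (K ^ p * (2 / Real.log 2) ^ (2 * p)) ?_
    filter_upwards [eventually_ge_atTop 2] with n hn
    have hn1 : 1 ≤ n := by omega
    have hn0 : (0 : ℝ) < n := by exact_mod_cast hn1
    have hA := (hf n hn1).posSemidef hα n
    have hB := (hg n hn1).posSemidef hβ n
    have hl2 : 0 < Real.log 2 := Real.log_pos (by norm_num)
    have hln : 0 ≤ Real.log n := Real.log_nonneg (by exact_mod_cast hn1)
    -- For n ≥ 2 the integer logarithm is at least 1, so adding 1 at most doubles it.
    have hJ : ((Nat.log 2 n + 1 : ℕ) : ℝ) ≤ 2 / Real.log 2 * Real.log n := by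
      have h1 : 1 ≤ Nat.log 2 n := Nat.le_log_of_pow_le (by norm_num) (by simpa using hn)
      have h2 : (Nat.log 2 n : ℝ) * Real.log 2 ≤ Real.log n := by
        rw [← Real.log_pow]
        exact Real.log_le_log (by positivity) (two_pow_log_le hn1).1
      have h3 : (1 : ℝ) ≤ Nat.log 2 n := by exact_mod_cast h1
      rw [div_mul_eq_mul_div, le_div_iff₀ hl2]
      push_cast
      nlinarith
    rw [trace_mul_pow_eq_re hA hB hp, Complex.norm_real, Real.norm_eq_abs,
      abs_of_nonneg (trace_mul_pow_re_nonneg hA hB hp), ← traceNorm_pow hA hB hp, Real.norm_eq_abs,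
      abs_of_nonneg (by positivity), Real.rpow_natCast]
    have h0 : 0 ≤ traceNorm p (toep n (f n)) (toep n (g n)) := traceNorm_nonneg hA hB hp
    calc traceNorm p (toep n (f n)) (toep n (g n)) ^ p
        ≤ (K * ((Nat.log 2 n + 1 : ℕ) : ℝ) ^ 2 * (n : ℝ) ^ (α + β)) ^ p :=
          pow_le_pow_left₀ h0 (h (f n) (g n) (hf n hn1) (hg n hn1) n hn1) p
      _ ≤ (K * (2 / Real.log 2 * Real.log n) ^ 2 * (n : ℝ) ^ (α + β)) ^ p := by gcongr
      _ = _ := by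
          rw [mul_comm (p : ℝ), Real.rpow_mul hn0.le, Real.rpow_natCast,
            mul_pow, mul_pow K, ← pow_mul, mul_pow (2 / Real.log 2)]
          ring
  · filter_upwards [eventually_ge_atTop 1] with n hn
    rw [Real.rpow_add (by exact_mod_cast hn)]
    ring

end Limit

/-! ### Extrapolation of powers from nonnegative parameters to -1. -/

section Interpolation

/-- The coefficients of the Lagrange extrapolation from `0, …, p` to `-1`. -/
noncomputable def extrapCoeff (p k : ℕ) : ℝ :=
  (Lagrange.basis (Finset.range (p + 1)) (fun i : ℕ => (i : ℝ)) k).eval (-1)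

/-- Interpolation at p + 1 nodes is exact on polynomials of degree at most p; here X^m is evaluated
at -1. -/
lemma sum_extrapCoeff_mul_pow {p m : ℕ} (hm : m ≤ p) :
    ∑ k ∈ Finset.range (p + 1), extrapCoeff p k * (k : ℝ) ^ m = (-1) ^ m := by
  have hinj : Set.InjOn (fun i : ℕ => (i : ℝ)) (Finset.range (p + 1)) :=
    Nat.cast_injective.injOn
  have hdeg : (Polynomial.X ^ m : Polynomial ℝ).degree < (Finset.range (p + 1)).card := by
    rw [Polynomial.degree_X_pow, Finset.card_range]
    exact_mod_cast Nat.lt_succ_of_le hm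
  have h := congrArg (Polynomial.eval (-1 : ℝ)) (Lagrange.eq_interpolate hinj hdeg)
  rw [Lagrange.interpolate_apply, Polynomial.eval_finsetSum] at h
  simp only [Polynomial.eval_pow, Polynomial.eval_X, Polynomial.eval_mul, Polynomial.eval_C] at h
  rw [h]
  exact Finset.sum_congr rfl fun k _ => mul_comm _ _

variable {R : Type*} [Ring R] [Algebra ℝ R]

lemma exists_pow_add_smul_eq (P Q : R) (p : ℕ) :
    ∃ M : ℕ → R, ∀ t : ℝ, (P + t • Q) ^ p = ∑ m ∈ Finset.range (p + 1), t ^ m • M m := by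
  induction p with
  | zero => exact ⟨fun _ => 1, fun t => by simp⟩
  | succ p ih =>
    obtain ⟨M, hM⟩ := ih
    -- P and Q need not commute, so the coefficients are built recursively. The conditions discard
    -- the values of M outside 0, …, p.
    refine ⟨fun m => (if m < p + 1 then M m * P else 0) +
      (if m = 0 then 0 else M (m - 1) * Q), fun t => ?_⟩
    rw [pow_succ, hM]
    simp only [smul_add, Finset.sum_add_distrib]
    rw [Finset.sum_range_succ _ (p + 1), Finset.sum_range_succ' (fun m => t ^ m •
      (if m = 0 then (0 : R) else M (m - 1) * Q))]
    simp only [lt_irrefl, if_false, if_true, smul_zero, add_zero, Nat.succ_ne_zero,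
      Nat.add_sub_cancel]
    rw [mul_add, Finset.sum_mul, Finset.sum_mul]
    congr 1
    · refine Finset.sum_congr rfl fun m hm => ?_
      rw [if_pos (Finset.mem_range.1 hm), smul_mul_assoc]
    · refine Finset.sum_congr rfl fun m _ => ?_
      rw [smul_mul_assoc, mul_smul_comm, smul_smul, pow_succ]

/-- `(P - Q)^p` is a fixed linear combination of the powers `(P + kQ)^p`, `0 ≤ k ≤ p`. -/
lemma sub_pow_eq_sum (P Q : R) (p : ℕ) :
    (P - Q) ^ p = ∑ k ∈ Finset.range (p + 1), extrapCoeff p k • (P + (k : ℝ) • Q) ^ p := by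
  obtain ⟨M, hM⟩ := exists_pow_add_smul_eq P Q p
  have h : P - Q = P + (-1 : ℝ) • Q := by rw [neg_smul, one_smul, sub_eq_add_neg]
  rw [h, hM]
  simp_rw [hM, Finset.smul_sum, smul_smul]
  rw [Finset.sum_comm]
  refine Finset.sum_congr rfl fun m hm => ?_
  rw [← Finset.sum_smul, sum_extrapCoeff_mul_pow (Nat.lt_succ_iff.1 (Finset.mem_range.1 hm))]

end Interpolation

/-! ### Reduction of signed symbols to nonnegative ones. -/

section Signed

/-- A real symbol on `[-π, π]` which is bounded by `C|x|^{-α}` in absolute value. -/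
structure IsSignedSymbol (C α : ℝ) (f : ℝ → ℝ) : Prop where
  aestronglyMeasurable : AEStronglyMeasurable f angleMeasure
  bound : ∀ᵐ x ∂angleMeasure, |f x| ≤ C * |x| ^ (-α)

/-- `f⁺ + t f⁻`. -/
noncomputable def blend (t : ℝ) (f : ℝ → ℝ) (x : ℝ) : ℝ := max (f x) 0 + t * max (-f x) 0

lemma eq_max_sub_max (f : ℝ → ℝ) (x : ℝ) : f x = max (f x) 0 - max (-f x) 0 := by
  rcases le_total 0 (f x) with h | h
  · rw [max_eq_left h, max_eq_right (by linarith)]; ring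
  · rw [max_eq_right h, max_eq_left (by linarith)]; ring

variable {C α β : ℝ} {f : ℝ → ℝ}

lemma IsSignedSymbol.pos (hf : IsSignedSymbol C α f) : IsSymbol C α (fun x => max (f x) 0) := by
  refine ⟨hf.aestronglyMeasurable.sup aestronglyMeasurable_const, ?_⟩
  filter_upwards [hf.bound] with x hx
  exact ⟨le_max_right _ _, max_le ((le_abs_self _).trans hx) ((abs_nonneg _).trans hx)⟩

lemma IsSignedSymbol.neg (hf : IsSignedSymbol C α f) : IsSymbol C α (fun x => max (-f x) 0) := by
  refine ⟨hf.aestronglyMeasurable.neg.sup aestronglyMeasurable_const, ?_⟩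
  filter_upwards [hf.bound] with x hx
  exact ⟨le_max_right _ _, max_le ((neg_le_abs _).trans hx) ((abs_nonneg _).trans hx)⟩

lemma IsSignedSymbol.blend (hf : IsSignedSymbol C α f) {t : ℝ} (ht : 0 ≤ t) :
    IsSymbol (C * (1 + t)) α (blend t f) := by
  refine ⟨hf.pos.aestronglyMeasurable.add (hf.neg.aestronglyMeasurable.const_mul t), ?_⟩
  filter_upwards [hf.pos.bound, hf.neg.bound] with x h1 h2
  refine ⟨add_nonneg h1.1 (mul_nonneg ht h2.1), ?_⟩
  calc max (f x) 0 + t * max (-f x) 0 ≤ C * |x| ^ (-α) + t * (C * |x| ^ (-α)) :=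
        add_le_add h1.2 (mul_le_mul_of_nonneg_left h2.2 ht)
    _ = _ := by ring

lemma IsSymbol.mono {C' : ℝ} (hf : IsSymbol C α f) (h : C ≤ C') : IsSymbol C' α f := by
  refine ⟨hf.aestronglyMeasurable, ?_⟩
  filter_upwards [hf.bound] with x hx
  exact ⟨hx.1, hx.2.trans (mul_le_mul_of_nonneg_right h (by positivity))⟩

lemma UnifConv.blend {f : ℕ → ℝ → ℝ} {F : ℝ → ℝ} (h : UnifConv f F) {t : ℝ} (ht : 0 ≤ t) :
    UnifConv (fun n => blend t (f n)) (blend t F) := by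
  intro δ hδ
  filter_upwards [h (δ / (1 + t)) (by positivity)] with n hn
  filter_upwards [hn] with x hx
  have h1 := abs_max_sub_max_le_abs (f n x) (F x) 0
  have h2 := abs_max_sub_max_le_abs (-f n x) (-F x) 0
  rw [neg_sub_neg, abs_sub_comm (F x)] at h2
  have e : Toeplitz.blend t (f n) x - Toeplitz.blend t F x =
      (max (f n x) 0 - max (F x) 0) + t * (max (-f n x) 0 - max (-F x) 0) := by
    simp only [Toeplitz.blend]; ring
  rw [e]
  calc _ ≤ |max (f n x) 0 - max (F x) 0| + |t * (max (-f n x) 0 - max (-F x) 0)| := abs_add_le _ _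
    _ ≤ δ / (1 + t) + t * (δ / (1 + t)) := by
        rw [abs_mul, abs_of_nonneg ht]
        exact add_le_add (h1.trans hx) (mul_le_mul_of_nonneg_left (h2.trans hx) ht)
    _ = δ := by field_simp

/-- The blend at t = -1 is f itself, while the blends at t = 0, …, p are nonnegative, so the
positive theory applies to every term on the right. -/
lemma toep_mul_pow_eq_sum (hα : α < 1) (hf : IsSignedSymbol C α f) {n : ℕ}
    (B : Matrix (Fin n) (Fin n) ℂ) (p : ℕ) :
    (toep n f * B) ^ p = ∑ k ∈ Finset.range (p + 1),
      extrapCoeff p k • (toep n (blend k f) * B) ^ p := by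
  have h1 := hf.pos.integrable hα
  have h2 := hf.neg.integrable hα
  have e1 : toep n f = toep n (fun x => max (f x) 0) - toep n (fun x => max (-f x) 0) := by
    rw [← toep_sub h1 h2]
    exact congrArg _ (funext fun x => eq_max_sub_max f x)
  have e2 : ∀ k : ℕ, toep n (blend k f) * B = toep n (fun x => max (f x) 0) * B +
      (k : ℝ) • (toep n (fun x => max (-f x) 0) * B) := fun k => by
    have : toep n (blend k f) = _ := toep_add h1 (h2.const_mul (k : ℝ)) n
    rw [this, toep_const_mul, add_mul, smul_mul_assoc]
    rfl
  rw [e1, sub_mul, sub_pow_eq_sum]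
  simp_rw [e2]

/-- The symbols `f_n`, `g_n` with limits `F`, `G` satisfy the limit theorem for the traces. -/
def TraceLimit (p : ℕ) (f g : ℕ → ℝ → ℝ) (F G : ℝ → ℝ) : Prop :=
  Integrable (fun x => (F x * G x) ^ p) angleMeasure ∧
    Tendsto (fun n : ℕ => (1 / (n : ℂ)) * ((toep n (f n) * toep n (g n)) ^ p).trace) atTop
      (𝓝 (((2 * Real.pi) ^ (2 * p - 1) * ∫ x, (F x * G x) ^ p ∂angleMeasure : ℝ) : ℂ))

lemma TraceLimit.symm {p : ℕ} (hp : 1 ≤ p) {f g : ℕ → ℝ → ℝ} {F G : ℝ → ℝ}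
    (h : TraceLimit p f g F G) : TraceLimit p g f G F := by
  simp_rw [TraceLimit, trace_mul_pow_comm (toep _ (g _)) _ hp, mul_comm (G _)]
  exact h

/-- The same extrapolation identity holds for the numbers (F x G x)^p, so the traces and their
limits combine with the same coefficients. -/
lemma TraceLimit.of_blend {p : ℕ} (hα : α < 1) {f g : ℕ → ℝ → ℝ} {F G : ℝ → ℝ}
    (hf : ∀ n, 1 ≤ n → IsSignedSymbol C α (f n))
    (h : ∀ k : ℕ, TraceLimit p (fun n => blend k (f n)) g (blend k F) G) :
    TraceLimit p f g F G := by
  have hpt : ∀ x, (F x * G x) ^ p =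
      ∑ k ∈ Finset.range (p + 1), extrapCoeff p k * (blend k F x * G x) ^ p := fun x => by
    conv_lhs => rw [eq_max_sub_max F x]
    rw [sub_mul, sub_pow_eq_sum]
    refine Finset.sum_congr rfl fun k _ => ?_
    rw [smul_eq_mul, smul_eq_mul, blend]
    ring
  have hint : ∀ k ∈ Finset.range (p + 1),
      Integrable (fun x => extrapCoeff p k * (blend k F x * G x) ^ p) angleMeasure :=
    fun k _ => (h k).1.const_mul _
  refine ⟨?_, ?_⟩
  · simp_rw [hpt]
    exact integrable_finsetSum _ hint
  · have hsum := tendsto_finsetSum (Finset.range (p + 1)) fun k _ =>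
      ((h k).2.const_mul (extrapCoeff p k : ℂ))
    have hval : ∑ k ∈ Finset.range (p + 1), (extrapCoeff p k : ℂ) *
        (((2 * Real.pi) ^ (2 * p - 1) * ∫ x, (blend k F x * G x) ^ p ∂angleMeasure : ℝ) : ℂ) =
        (((2 * Real.pi) ^ (2 * p - 1) * ∫ x, (F x * G x) ^ p ∂angleMeasure : ℝ) : ℂ) := by
      simp_rw [hpt]
      rw [integral_finsetSum _ hint, Finset.mul_sum]
      push_cast
      refine Finset.sum_congr rfl fun k _ => ?_
      rw [integral_const_mul]
      push_cast; ring
    rw [hval] at hsum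
    refine hsum.congr' ?_
    filter_upwards [eventually_ge_atTop 1] with n hn
    rw [toep_mul_pow_eq_sum hα (hf n hn), Matrix.trace_sum, Finset.mul_sum]
    refine Finset.sum_congr rfl fun k _ => ?_
    rw [Matrix.trace_smul, Complex.real_smul]
    ring

lemma isLittleO_trace_of_blend {p : ℕ} (hα : α < 1) {f g : ℕ → ℝ → ℝ} {u : ℕ → ℝ}
    (hf : ∀ n, 1 ≤ n → IsSignedSymbol C α (f n))
    (h : ∀ k : ℕ, (fun n : ℕ => ((toep n (blend k (f n)) * toep n (g n)) ^ p).trace) =o[atTop] u) :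
    (fun n : ℕ => ((toep n (f n) * toep n (g n)) ^ p).trace) =o[atTop] u := by
  have hsum : (fun n : ℕ => ∑ k ∈ Finset.range (p + 1),
      (extrapCoeff p k : ℂ) * ((toep n (blend k (f n)) * toep n (g n)) ^ p).trace) =o[atTop] u :=
    IsLittleO.fun_sum fun k _ => (h k).const_mul_left _
  refine hsum.congr' ?_ EventuallyEq.rfl
  filter_upwards [eventually_ge_atTop 1] with n hn
  rw [toep_mul_pow_eq_sum hα (hf n hn), Matrix.trace_sum]
  refine Finset.sum_congr rfl fun k _ => ?_
  rw [Matrix.trace_smul, Complex.real_smul]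

/-- The limit theorem for real symbols. -/
lemma traceLimit_of_isSignedSymbol {p : ℕ} (hp : 1 ≤ p) (hC : 0 ≤ C) (hα : α < 1) (hβ : β < 1)
    (hs : (p : ℝ) * (α + β) < 1) {f g : ℕ → ℝ → ℝ} {F G : ℝ → ℝ}
    (hf : ∀ n, 1 ≤ n → IsSignedSymbol C α (f n)) (hg : ∀ n, 1 ≤ n → IsSignedSymbol C β (g n))
    (hF : IsSignedSymbol C α F) (hG : IsSignedSymbol C β G)
    (hfF : UnifConv f F) (hgG : UnifConv g G) : TraceLimit p f g F G := by
  have key : ∀ k l : ℕ, TraceLimit p (fun n => blend k (f n)) (fun n => blend l (g n))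
      (blend k F) (blend l G) := by
    intro k l
    have hk : (0 : ℝ) ≤ k := Nat.cast_nonneg k
    have hl : (0 : ℝ) ≤ l := Nat.cast_nonneg l
    have h1 : C * (1 + (k : ℝ)) ≤ C * (1 + k + l) :=
      mul_le_mul_of_nonneg_left (by linarith) hC
    have h2 : C * (1 + (l : ℝ)) ≤ C * (1 + k + l) :=
      mul_le_mul_of_nonneg_left (by linarith) hC
    have hF' := (hF.blend hk).mono h1
    have hG' := (hG.blend hl).mono h2
    exact ⟨integrable_mul_pow hs hF' hG',
      tendsto_trace_of_isSymbol hp (by positivity) hα hβ hs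
        (fun n hn => ((hf n hn).blend hk).mono h1) (fun n hn => ((hg n hn).blend hl).mono h2)
        hF' hG' (hfF.blend hk) (hgG.blend hl)⟩
  -- The reduction acts on the first symbol only; exchanging the symbols treats the second.
  exact (TraceLimit.of_blend hβ hg fun l =>
    (TraceLimit.of_blend hα hf fun k => key k l).symm hp).symm hp

/-- The growth theorem for real symbols. -/
lemma isLittleO_trace_of_isSignedSymbol {p : ℕ} (hp : 1 ≤ p) (hC : 0 ≤ C) (hα : α < 1)
    (hβ : β < 1) (hs : 1 ≤ (p : ℝ) * (α + β)) {f g : ℕ → ℝ → ℝ}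
    (hf : ∀ n, 1 ≤ n → IsSignedSymbol C α (f n)) (hg : ∀ n, 1 ≤ n → IsSignedSymbol C β (g n))
    {ψ : ℝ} (hψ : 0 < ψ) :
    (fun n : ℕ => ((toep n (f n) * toep n (g n)) ^ p).trace) =o[atTop]
      fun n : ℕ => (n : ℝ) ^ ((p : ℝ) * (α + β) + ψ) := by
  have key : ∀ k l : ℕ,
      (fun n : ℕ => ((toep n (blend k (f n)) * toep n (blend l (g n))) ^ p).trace) =o[atTop]
        fun n : ℕ => (n : ℝ) ^ ((p : ℝ) * (α + β) + ψ) := by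
    intro k l
    have hk : (0 : ℝ) ≤ k := Nat.cast_nonneg k
    have hl : (0 : ℝ) ≤ l := Nat.cast_nonneg l
    have h1 : C * (1 + (k : ℝ)) ≤ C * (1 + k + l) :=
      mul_le_mul_of_nonneg_left (by linarith) hC
    have h2 : C * (1 + (l : ℝ)) ≤ C * (1 + k + l) :=
      mul_le_mul_of_nonneg_left (by linarith) hC
    exact isLittleO_trace_of_isSymbol hp (by positivity) hα hβ hs
        (fun n hn => ((hf n hn).blend hk).mono h1) (fun n hn => ((hg n hn).blend hl).mono h2) hψ
  simp_rw [trace_mul_pow_comm (toep _ (f _)) _ hp]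
  refine isLittleO_trace_of_blend hβ hg fun l => ?_
  simp_rw [trace_mul_pow_comm (toep _ (blend _ (g _))) _ hp]
  exact isLittleO_trace_of_blend hα hf fun k => key k l

/-- Members of the sequence within 1/(j+1) of F converge to it almost everywhere, so measurability
and the power bound pass to the limit. -/
lemma UnifConv.isSignedSymbol {f : ℕ → ℝ → ℝ} {F : ℝ → ℝ} (h : UnifConv f F)
    (hf : ∀ n, 1 ≤ n → IsSignedSymbol C α (f n)) : IsSignedSymbol C α F := by
  have hex : ∀ j : ℕ, ∃ n, 1 ≤ n ∧ ∀ᵐ x ∂angleMeasure, |f n x - F x| ≤ 1 / ((j : ℝ) + 1) :=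
    fun j => ((eventually_ge_atTop 1).and (h _ Nat.one_div_pos_of_nat)).exists
  choose N hN1 hN2 using hex
  have hlim : ∀ᵐ x ∂angleMeasure, Tendsto (fun j => f (N j) x) atTop (𝓝 (F x)) := by
    filter_upwards [ae_all_iff.2 hN2] with x hx
    rw [tendsto_iff_norm_sub_tendsto_zero]
    exact squeeze_zero (fun _ => norm_nonneg _) hx tendsto_one_div_add_atTop_nhds_zero_nat
  refine ⟨aestronglyMeasurable_of_tendsto_ae atTop
    (fun j => (hf (N j) (hN1 j)).aestronglyMeasurable) hlim, ?_⟩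
  filter_upwards [hlim, ae_all_iff.2 fun j => (hf (N j) (hN1 j)).bound] with x h1 h2
  exact le_of_tendsto' h1.abs h2

end Signed

/-! ### From extended-real to real symbols. -/

section ExtendedReal

/-- Away from 0 the weight |x|^α is positive, so an infinite value would make the supremum infinite.
-/
lemma exists_bound_of_uniformPowerBound {α : ℝ} {k : ℕ → ℝ → EReal}
    (h : UniformPowerBound α k) : ∃ C : ℝ, 0 ≤ C ∧ ∀ n, 1 ≤ n →
      ∀ x ∈ Set.Icc (-Real.pi) Real.pi, x ≠ 0 →
        ∃ r : ℝ, k n x = (r : EReal) ∧ |r| ≤ C * |x| ^ (-α) := by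
  set S := ⨆ (n : ℕ) (_ : 1 ≤ n) (x : ℝ) (_ : x ∈ Set.Icc (-Real.pi) Real.pi \ {0}),
    ENNReal.ofReal (|x| ^ α) * (k n x).abs with hS
  have hS' : S < ⊤ := h
  refine ⟨S.toReal, ENNReal.toReal_nonneg, fun n hn x hx hx0 => ?_⟩
  have hxa : 0 < |x| := abs_pos.2 hx0
  have hpos : 0 < |x| ^ α := Real.rpow_pos_of_pos hxa α
  have hle : ENNReal.ofReal (|x| ^ α) * (k n x).abs ≤ S :=
    le_iSup₂_of_le n hn (le_iSup₂_of_le x ⟨hx, hx0⟩ le_rfl)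
  have hne : ENNReal.ofReal (|x| ^ α) ≠ 0 := by simpa using hpos
  induction hk : k n x with
  | bot => rw [hk, EReal.abs_bot, ENNReal.mul_top hne] at hle; exact absurd hle (not_le.2 hS')
  | top => rw [hk, EReal.abs_top, ENNReal.mul_top hne] at hle; exact absurd hle (not_le.2 hS')
  | coe r =>
    refine ⟨r, rfl, ?_⟩
    rw [hk, EReal.abs_def, ← ENNReal.ofReal_mul hpos.le] at hle
    have := ENNReal.toReal_mono hS'.ne hle
    rw [ENNReal.toReal_ofReal (by positivity)] at this
    rw [Real.rpow_neg hxa.le, ← div_eq_mul_inv, le_div_iff₀ hpos, mul_comm]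
    exact this

lemma unifConv_of_tendstoEssSup {k : ℕ → ℝ → EReal} {l : ℝ → EReal}
    (h : TendstoEssSup k l) (hk : ∀ n, 1 ≤ n → ∀ x ∈ Set.Icc (-Real.pi) Real.pi, x ≠ 0 →
      ∃ r : ℝ, k n x = (r : EReal)) :
    UnifConv (fun n x => (k n x).toReal) (fun x => (l x).toReal) := by
  intro δ hδ
  have hev := Tendsto.eventually_lt_const (ENNReal.ofReal_pos.2 hδ) h
  filter_upwards [hev, eventually_ge_atTop 1] with n hn hn1
  filter_upwards [ae_lt_of_essSup_lt hn, ae_ne_zero, ae_restrict_mem measurableSet_Icc]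
    with x hx hx0 hxI
  obtain ⟨r, hr⟩ := hk n hn1 x hxI hx0
  rw [hr] at hx
  simp only [hr, EReal.toReal_coe]
  -- An infinite value of the limit, against a finite value of the sequence, would make the
  -- difference infinite, contrary to the bound δ.
  induction hl : l x with
  | bot => rw [hl] at hx; simp at hx
  | top => rw [hl] at hx; simp at hx
  | coe b =>
    rw [hl, ← EReal.coe_sub, EReal.abs_def, ENNReal.ofReal_lt_ofReal_iff hδ] at hx
    simpa using hx.le

/-- `EReal.toReal` is multiplicative without any finiteness assumption, since it sends ±∞ to 0. -/
lemma toReal_pow (a : EReal) (p : ℕ) : (a ^ p).toReal = a.toReal ^ p := by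
  induction p with
  | zero => simp
  | succ p ih => rw [pow_succ, pow_succ, EReal.toReal_mul, ih]

lemma isSignedSymbol_toReal {C α : ℝ} {k : ℝ → EReal}
    (hm : AEMeasurable k (volume.restrict (Set.Icc (-Real.pi) Real.pi)))
    (h : ∀ x ∈ Set.Icc (-Real.pi) Real.pi, x ≠ 0 →
      ∃ r : ℝ, k x = (r : EReal) ∧ |r| ≤ C * |x| ^ (-α)) :
    IsSignedSymbol C α (fun x => (k x).toReal) := by
  refine ⟨(measurable_ereal_toReal.comp_aemeasurable hm).aestronglyMeasurable, ?_⟩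
  filter_upwards [ae_ne_zero, ae_restrict_mem measurableSet_Icc] with x hx0 hxI
  obtain ⟨r, hr, hb⟩ := h x hxI hx0
  simpa [hr] using hb

lemma toeplitzTrace_eq (n p : ℕ) (f g : ℝ → EReal) :
    toeplitzTrace n p f g =
      ((toep n (fun x => (f x).toReal) * toep n (fun x => (g x).toReal)) ^ p).trace := rfl

lemma IsSignedSymbol.mono {C C' α : ℝ} {f : ℝ → ℝ} (hf : IsSignedSymbol C α f) (h : C ≤ C') :
    IsSignedSymbol C' α f := by
  refine ⟨hf.aestronglyMeasurable, ?_⟩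
  filter_upwards [hf.bound] with x hx
  exact hx.trans (mul_le_mul_of_nonneg_right h (by positivity))

end ExtendedReal

end Toeplitz

theorem theoremE3 (α₁ α₂ : ℝ) (hα₁ : α₁ < 1) (hα₂ : α₂ < 1) (p : ℕ) (hp : 1 ≤ p)
    (k₁ k₂ : ℕ → ℝ → EReal)
    (hmeas₁ : ∀ n, 1 ≤ n →
      AEMeasurable (k₁ n) (volume.restrict (Set.Icc (-Real.pi) Real.pi)))
    (hmeas₂ : ∀ n, 1 ≤ n →
      AEMeasurable (k₂ n) (volume.restrict (Set.Icc (-Real.pi) Real.pi)))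
    (heven₁ : ∀ n, 1 ≤ n → EvenOnInterval (k₁ n))
    (heven₂ : ∀ n, 1 ≤ n → EvenOnInterval (k₂ n))
    (hbound₁ : UniformPowerBound α₁ k₁) (hbound₂ : UniformPowerBound α₂ k₂)
    (l₁ l₂ : ℝ → EReal)
    (hlim₁ : TendstoEssSup k₁ l₁) (hlim₂ : TendstoEssSup k₂ l₂)
    (hdisc₁ : NullDiscontinuities l₁) (hdisc₂ : NullDiscontinuities l₂) :
    ((p : ℝ) * (α₁ + α₂) < 1 →
      IntegrableOn (fun x => ((l₁ x * l₂ x) ^ p).toReal) (Set.Icc (-Real.pi) Real.pi) ∧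
      Tendsto (fun n : ℕ => (1 / (n : ℂ)) * toeplitzTrace n p (k₁ n) (k₂ n)) atTop
        (𝓝 (((2 * Real.pi) ^ (2 * p - 1) *
          ∫ x in Set.Icc (-Real.pi) Real.pi, ((l₁ x * l₂ x) ^ p).toReal : ℝ) : ℂ))) ∧
    (1 ≤ (p : ℝ) * (α₁ + α₂) → ∀ ψ : ℝ, 0 < ψ →
      (fun n : ℕ => toeplitzTrace n p (k₁ n) (k₂ n)) =o[atTop]
        fun n : ℕ => (n : ℝ) ^ ((p : ℝ) * (α₁ + α₂) + ψ)) := by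
  obtain ⟨C₁, hC₁, hb₁⟩ := Toeplitz.exists_bound_of_uniformPowerBound hbound₁
  obtain ⟨C₂, hC₂, hb₂⟩ := Toeplitz.exists_bound_of_uniformPowerBound hbound₂
  -- The sum C₁ + C₂ is a constant common to both symbols, as the real-symbol theorems require.
  have hs₁ : ∀ n, 1 ≤ n →
      Toeplitz.IsSignedSymbol (C₁ + C₂) α₁ (fun x => (k₁ n x).toReal) := fun n hn =>
    (Toeplitz.isSignedSymbol_toReal (hmeas₁ n hn) (hb₁ n hn)).mono (by linarith)
  have hs₂ : ∀ n, 1 ≤ n →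
      Toeplitz.IsSignedSymbol (C₁ + C₂) α₂ (fun x => (k₂ n x).toReal) := fun n hn =>
    (Toeplitz.isSignedSymbol_toReal (hmeas₂ n hn) (hb₂ n hn)).mono (by linarith)
  have hu₁ := Toeplitz.unifConv_of_tendstoEssSup hlim₁ fun n hn x hx hx0 =>
    (hb₁ n hn x hx hx0).imp fun _ h => h.1
  have hu₂ := Toeplitz.unifConv_of_tendstoEssSup hlim₂ fun n hn x hx hx0 =>
    (hb₂ n hn x hx hx0).imp fun _ h => h.1
  have hC : 0 ≤ C₁ + C₂ := by positivity
  constructor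
  · intro hs
    have h := Toeplitz.traceLimit_of_isSignedSymbol hp hC hα₁ hα₂ hs hs₁ hs₂
      (hu₁.isSignedSymbol hs₁) (hu₂.isSignedSymbol hs₂) hu₁ hu₂
    simp_rw [Toeplitz.toReal_pow, EReal.toReal_mul, Toeplitz.toeplitzTrace_eq]
    exact h
  · intro hs ψ hψ
    simp_rw [Toeplitz.toeplitzTrace_eq]
    exact Toeplitz.isLittleO_trace_of_isSignedSymbol hp hC hα₁ hα₂ hs hs₁ hs₂ hψ
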